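/- Let $(\omega_n)_{n\ge 0}$ be i.i.d. real random variables with $M(\beta):=\mathbb{E}[\exp(\beta\omega_1)]<\infty$ for every $\beta>0$, and let $s\ge 2$ be an integer. For $\beta\ge 0$ and $h\in\mathbb{R}$ define the partition functions of the hierarchical pinning model of Derrida, Hakim and Vannimenus with $b=s$ by $$R_0^{(i)}=\exp\bigl(\beta\omega_i+h-\log M(\beta)\bigr),\qquad R_{n+1}^{(i)}=\frac{\prod_{j=1}^{s}R_n^{(si+j)}+s-1}{s}\qquad(n,i\in\mathbb{N}).$$ Then for all $\beta\ge 0$ and $h\in\mathbb{R}$ the limit $F(\beta,h):=\lim_{N\to\infty}s^{-N}\log R_N^{(1)}$ (the quenched free energy) exists almost surely and in $L^1(\mathbb{P})$ and is a constant. With the critical point $h_c(\beta):=\inf\{h\in\mathbb{R}: F(\beta,h)>0\}$, where the infimum is taken in $[-\infty,+\infty]$, one has $$h_c(\beta)=h_c(0)=0\qquad\text{for every }\beta>0 .$$ -/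

import Mathlib

open MeasureTheory ProbabilityTheory Filter Topology

noncomputable section

namespace HierarchicalPinning

variable {Ω : Type*} [MeasurableSpace Ω]

/-- The partition functions `R_n^{(i)}` of the hierarchical pinning model with parameters `b`, `s`,
disorder `ω`, inverse temperature `β` and pinning parameter `h`. Here `mgf (ω 1) μ β` is
`M(β) = 𝔼[exp (β ω₁)]`, with the expectation taken under `μ`. -/
def partitionFn (μ : Measure Ω) (ω : ℕ → Ω → ℝ) (b s : ℕ) (β h : ℝ) : ℕ → ℕ → Ω → ℝ
  | 0, i, x => Real.exp (β * ω i x + h - Real.log (mgf (ω 1) μ β))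
  | n + 1, i, x =>
      ((∏ j ∈ Finset.Icc 1 s, partitionFn μ ω b s β h n (s * i + j) x) + ((b : ℝ) - 1)) / (b : ℝ)

/-- The finite-volume (random) free energy `s^{-N} log R_N^{(1)}`. -/
def finiteFreeEnergy (μ : Measure Ω) (ω : ℕ → Ω → ℝ) (b s : ℕ) (β h : ℝ) (N : ℕ) (x : Ω) : ℝ :=
  1 / (s : ℝ) ^ N * Real.log (partitionFn μ ω b s β h N 1 x)

/-- The constant `f` is the limit of `s^{-N} log R_N^{(1)}`, almost surely and in `L¹`. -/
def IsFreeEnergy (μ : Measure Ω) (ω : ℕ → Ω → ℝ) (b s : ℕ) (β h f : ℝ) : Prop :=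
  (∀ᵐ x ∂μ, Tendsto (fun N => finiteFreeEnergy μ ω b s β h N x) atTop (𝓝 f)) ∧
    Tendsto (fun N => eLpNorm (fun x => finiteFreeEnergy μ ω b s β h N x - f) 1 μ) atTop (𝓝 0)

/-- The free energy `F(β, h)`: the (unique) constant to which `s^{-N} log R_N^{(1)}` converges
almost surely and in `L¹`. -/
def freeEnergy (μ : Measure Ω) (ω : ℕ → Ω → ℝ) (b s : ℕ) (β h : ℝ) : ℝ :=
  Classical.epsilon (IsFreeEnergy μ ω b s β h)

/-- The critical point `h_c(β) = inf {h ∈ ℝ : F(β, h) > 0}`. The infimum is taken in the extended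
reals, so it is `⊤` for the empty set and `⊥` for a set that is not bounded below. -/
def criticalPoint (μ : Measure Ω) (ω : ℕ → Ω → ℝ) (b s : ℕ) (β : ℝ) : EReal :=
  sInf ((fun h : ℝ => (h : EReal)) '' {h : ℝ | 0 < freeEnergy μ ω b s β h})

end HierarchicalPinning

end

/-! For `h ≤ 0` the means satisfy `𝔼 R_n ≤ 1`, so Jensen gives `𝔼 log R_n ≤ 0` and the free energy
is not positive. The content is that it is positive for every `h > 0`. The map `p ↦ (p ^ s + s - 1)
/ s` has the fixed point `1` with slope exactly `1`, so at `h = 0` the mean stays equal to `1`, and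
a perturbation of `h` is neither amplified nor contracted exponentially to first order. The proof
shows that the disorder, by contrast, is contracted exponentially fast.

At `h = 0`, multiplying `s` independent copies multiplies the relative entropy by `s`, and the
affine map divides it by at least `s`, with a loss proportional to the squared Hellinger distance
(`entropy_step_le`). By Cauchy-Schwarz this loss is at least the squared entropy over the second
size-biased logarithmic moment, and that moment grows at most linearly (`sqLogMoment_step_le`). As
the harmonic series diverges, the entropy gets arbitrarily small (`exists_entropy_lt`). For small
`θ` the excess of the moment of order `1 + θ` over `1` is then small enough for its recursion, of
linear rate `s ^ (-θ)`, to be a contraction. Hence the entropy, and with it `-𝔼 log R_n`, decays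
geometrically (`exists_neg_logMean_le_geometric`).

Now compare `h > 0` with `h = 0`. By convexity of `t ↦ log ((exp t + s - 1) / s)`, the gap between
the two mean logarithms shrinks in each step by a factor no worse than the slope at a deterministic
lower bound; that bound tends to `1`, so the slopes tend to `1` and the gap cannot decay
geometrically. If the mean logarithm for `h > 0` were never positive, the gap would be at most `-𝔼
log R_n` at `h = 0`, a contradiction (`exists_logMean_pos`). Once positive, the mean logarithm grows
at least linearly and passes `2`, where the rate of convergence in `exists_limit_logMean` forces a
positive limit.

The free energy exists because `log R_{n+1}` differs from the sum of the logarithms over the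
children by at most `s` once all variables are at least `1 / 2`; after fixing a generation, the law
of large numbers applies to its independent logarithms. -/

namespace HierarchicalPinning

/-! ### The recursion preserves i.i.d. positive families with all moments. -/

variable {Ω : Type*} {s : ℕ} {X : ℕ → Ω → ℝ}

/-- One step of the hierarchical recursion with `b = s`, acting on families of random variables. -/
noncomputable def step (s : ℕ) (X : ℕ → Ω → ℝ) (i : ℕ) (x : Ω) : ℝ :=
  (∏ j ∈ Finset.Icc 1 s, X (s * i + j) x + ((s : ℝ) - 1)) / s

variable [MeasurableSpace Ω] {μ : Measure Ω}

theorem partitionFn_eq_iterate_step (ω : ℕ → Ω → ℝ) (s : ℕ) (β h : ℝ) (n : ℕ) :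
    partitionFn μ ω s s β h n = (step s)^[n] (partitionFn μ ω s s β h 0) := by
  induction n with
  | zero => rfl
  | succ n ih => rw [Function.iterate_succ_apply', ← ih]; rfl

/-- A family of i.i.d. positive random variables with finite moments of all orders. -/
structure IsIIDPos (μ : Measure Ω) (X : ℕ → Ω → ℝ) : Prop where
  meas : ∀ i, Measurable (X i)
  indep : iIndepFun X μ
  ident : ∀ i, IdentDistrib (X i) (X 1) μ μ
  pos : ∀ i x, 0 < X i x
  moments : ∀ p : ℕ, Integrable (fun x => X 1 x ^ p) μ

theorem child_index_inj {s i i' j j' : ℕ} (hj : j ∈ Finset.Icc 1 s) (hj' : j' ∈ Finset.Icc 1 s)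
    (h : s * i + j = s * i' + j') : i = i' ∧ j = j' := by
  rw [Finset.mem_Icc] at hj hj'
  have hi : i = i' := by
    rcases lt_trichotomy i i' with hlt | heq | hlt
    · have := Nat.mul_le_mul_left s (Nat.succ_le_of_lt hlt)
      rw [Nat.mul_succ] at this; omega
    · exact heq
    · have := Nat.mul_le_mul_left s (Nat.succ_le_of_lt hlt)
      rw [Nat.mul_succ] at this; omega
  subst hi
  exact ⟨rfl, by omega⟩

/-- The children of a fixed vertex are independent. -/
theorem iIndepFun_children (hX : iIndepFun X μ) (i : ℕ) :
    iIndepFun (fun (j : Finset.Icc 1 s) => X (s * i + j)) μ :=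
  hX.precomp (g := fun j : Finset.Icc 1 s => s * i + (j : ℕ)) fun j j' h =>
    Subtype.ext (child_index_inj j.2 j'.2 h).2

/-- The families of children of distinct vertices are independent. -/
theorem iIndepFun_families (hmeas : ∀ i, Measurable (X i)) (hX : iIndepFun X μ) :
    iIndepFun (fun (i : ℕ) (x : Ω) (j : Finset.Icc 1 s) => X (s * i + j) x) μ := by
  have := hX.isProbabilityMeasure
  have hp : ∀ i, IsProbabilityMeasure (μ.map (X i)) := fun i =>
    Measure.isProbabilityMeasure_map (hmeas i).aemeasurable
  have hpair : iIndepFun (fun (p : ℕ × Finset.Icc 1 s) => X (s * p.1 + p.2)) μ := by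
    refine hX.precomp (g := fun p : ℕ × Finset.Icc 1 s => s * p.1 + (p.2 : ℕ)) ?_
    rintro ⟨i, j⟩ ⟨i', j'⟩ h
    obtain ⟨h1, h2⟩ := child_index_inj j.2 j'.2 h
    exact Prod.ext h1 (Subtype.ext h2)
  rw [iIndepFun_iff_map_fun_eq_infinitePi_map (fun i => by fun_prop)]
  have h2 := hpair.map_fun_eq_infinitePi_map (fun p => hmeas _)
  -- Reindexed by pairs (vertex, child), the joint law is an infinite product; currying it exhibits
  -- it as a product over vertices of product laws.
  have h3 := congrArg (Measure.map (MeasurableEquiv.curry ℕ (Finset.Icc 1 s) ℝ)) h2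
  rw [Measure.map_map (by fun_prop) (by fun_prop)] at h3
  have h4 := Measure.infinitePi_map_curry
    (fun (i : ℕ) (j : Finset.Icc 1 s) => μ.map (X (s * i + j)))
  refine Eq.trans ?_ (h3.trans (h4.trans ?_))
  · rfl
  · congr with i
    rw [(iIndepFun_children (s := s) hX i).map_fun_eq_infinitePi_map fun j => hmeas _]

theorem measurable_step (hmeas : ∀ i, Measurable (X i)) (i : ℕ) : Measurable (step s X i) := by
  unfold step
  exact ((Finset.measurable_fun_prod _ fun j _ => hmeas _).add_const _).div_const _

theorem iIndepFun_step (hmeas : ∀ i, Measurable (X i)) (hX : iIndepFun X μ) :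
    iIndepFun (step s X) μ := by
  have h := (iIndepFun_families (s := s) hmeas hX).comp
    (fun (_ : ℕ) (v : Finset.Icc 1 s → ℝ) => (∏ j, v j + ((s : ℝ) - 1)) / s)
    (fun i => by fun_prop)
  convert h using 2 with i
  funext x
  simp only [step, Function.comp]
  rw [← Finset.prod_coe_sort]

theorem identDistrib_step (hX : iIndepFun X μ)
    (hid : ∀ i, IdentDistrib (X i) (X 1) μ μ) (i : ℕ) :
    IdentDistrib (step s X i) (step s X 1) μ μ := by
  have h := IdentDistrib.pi (fun j : Finset.Icc 1 s => (hid (s * i + j)).trans (hid (s * 1 + j)).symm)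
    (iIndepFun_children hX i) (iIndepFun_children hX 1)
  have h2 := h.comp (u := fun v : Finset.Icc 1 s → ℝ => (∏ j, v j + ((s : ℝ) - 1)) / s)
    (by fun_prop)
  convert h2 using 1 <;>
  · funext x
    simp only [step, Function.comp]
    rw [← Finset.prod_coe_sort]

namespace IsIIDPos

theorem integral_prod_children (hX : IsIIDPos μ X) (i : ℕ) {g : ℕ → ℝ → ℝ}
    (hg : ∀ j, Measurable (g j)) :
    ∫ x, ∏ j ∈ Finset.Icc 1 s, g j (X (s * i + j) x) ∂μ
      = ∏ j ∈ Finset.Icc 1 s, ∫ x, g j (X 1 x) ∂μ := by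
  have h := (iIndepFun_children (s := s) hX.indep i).integral_fun_prod_comp
    (f := fun (j : Finset.Icc 1 s) => g j) (fun j => (hX.meas _).aemeasurable)
    (fun j => (hg j).aestronglyMeasurable)
  rw [← Finset.prod_coe_sort]
  calc _ = ∫ x, ∏ j : Finset.Icc 1 s, g j (X (s * i + j) x) ∂μ := by
        congr 1; funext x; rw [← Finset.prod_coe_sort]
    _ = _ := h
    _ = _ := by
        refine Finset.prod_congr rfl fun j _ => ?_
        exact ((hX.ident _).comp (hg j)).integral_eq

theorem integrable_prod_children (hX : IsIIDPos μ X) (i : ℕ) {g : ℕ → ℝ → ℝ}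
    (hg : ∀ j, Measurable (g j)) (hint : ∀ j, Integrable (fun x => g j (X 1 x)) μ) :
    Integrable (fun x => ∏ j ∈ Finset.Icc 1 s, g j (X (s * i + j) x)) μ := by
  have := hX.indep.isProbabilityMeasure
  have hp : ∀ i, IsProbabilityMeasure (μ.map (X i)) := fun i =>
    Measure.isProbabilityMeasure_map (hX.meas i).aemeasurable
  have h1 : Integrable (fun v : Finset.Icc 1 s → ℝ => ∏ j : Finset.Icc 1 s, g j (v j))
      (Measure.pi fun j : Finset.Icc 1 s => μ.map (X (s * i + j))) := by
    refine Integrable.fintype_prod (f := fun (j : Finset.Icc 1 s) y => g j y) fun j => ?_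
    rw [(hX.ident _).map_eq]
    exact (integrable_map_measure (hg j).aestronglyMeasurable
      (hX.meas _).aemeasurable).2 (hint j)
  rw [← (iIndepFun_children (s := s) hX.indep i).map_fun_eq_pi_map
    fun j => (hX.meas _).aemeasurable] at h1
  have h2 := h1.comp_measurable (measurable_pi_lambda _ fun j => hX.meas _)
  refine h2.congr (ae_of_all _ fun x => ?_)
  exact Finset.prod_coe_sort (Finset.Icc 1 s) fun j => g j (X (s * i + j) x)

theorem step (hX : IsIIDPos μ X) (hs : 2 ≤ s) : IsIIDPos μ (step s X) where
  meas := measurable_step hX.meas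
  indep := iIndepFun_step hX.meas hX.indep
  ident := identDistrib_step hX.indep hX.ident
  pos i x := by
    have : (2 : ℝ) ≤ s := by exact_mod_cast hs
    have h := Finset.prod_pos (s := Finset.Icc 1 s) fun j _ => hX.pos (s * i + j) x
    unfold HierarchicalPinning.step
    apply div_pos <;> linarith
  moments p := by
    have := hX.indep.isProbabilityMeasure
    have hs2 : (2 : ℝ) ≤ s := by exact_mod_cast hs
    have h := hX.integrable_prod_children (s := s) 1 (g := fun _ y => y ^ p)
      (fun _ => by fun_prop) (fun _ => hX.moments p)
    refine (h.add (integrable_const (1 : ℝ))).mono'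
      (((measurable_step hX.meas 1).pow_const p).aestronglyMeasurable) (ae_of_all _ fun x => ?_)
    simp only [Pi.add_apply, Finset.prod_pow]
    have hP := Finset.prod_pos (s := Finset.Icc 1 s) fun j _ => hX.pos (s * 1 + j) x
    set P := ∏ j ∈ Finset.Icc 1 s, X (s * 1 + j) x with hPdef
    have hst : HierarchicalPinning.step s X 1 x = (P + (s - 1)) / s := rfl
    have h0 : 0 ≤ HierarchicalPinning.step s X 1 x := by
      rw [hst]; apply div_nonneg <;> linarith
    rw [Real.norm_eq_abs, abs_of_nonneg (pow_nonneg h0 p)]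
    -- The step is an average of `P` and `1`, so its `p`-th power is at most `P ^ p + 1`.
    rcases le_total P 1 with h1 | h1
    · have : HierarchicalPinning.step s X 1 x ≤ 1 := by
        rw [hst, div_le_one (by linarith)]; linarith
      have := pow_le_one₀ h0 this (n := p)
      have := pow_pos hP p
      linarith
    · have : HierarchicalPinning.step s X 1 x ≤ P := by
        rw [hst, div_le_iff₀ (by linarith)]; nlinarith
      have := pow_le_pow_left₀ h0 this p
      linarith

theorem iterate_step (hX : IsIIDPos μ X) (hs : 2 ≤ s) (n : ℕ) :
    IsIIDPos μ ((HierarchicalPinning.step s)^[n] X) := by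
  induction n with
  | zero => exact hX
  | succ n ih => rw [Function.iterate_succ_apply']; exact ih.step hs

end IsIIDPos

end HierarchicalPinning

/-! ### Pointwise inequalities for the affine map `x ↦ (x + (σ - 1)) / σ`. -/

namespace HierarchicalPinning

/-- Tangent line at `t = log p` of the convex function `t ↦ log ((exp t + σ - 1) / σ)`. It follows
from concavity of `log` at the points `x / p` and `1`. -/
theorem log_affine_tangent {σ x p : ℝ} (hσ : 1 ≤ σ) (hx : 0 < x) (hp : 0 < p) :
    Real.log ((p + (σ - 1)) / σ) + p / (p + (σ - 1)) * (Real.log x - Real.log p)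
      ≤ Real.log ((x + (σ - 1)) / σ) := by
  have hd : 0 < p + (σ - 1) := by linarith
  have hd' : 0 < x + (σ - 1) := by linarith
  have hc := strictConcaveOn_log_Ioi.concaveOn.2
    (Set.mem_Ioi.2 (div_pos hx hp)) (Set.mem_Ioi.2 one_pos)
    (show 0 ≤ p / (p + (σ - 1)) by positivity)
    (show 0 ≤ (σ - 1) / (p + (σ - 1)) from div_nonneg (by linarith) hd.le) (by field_simp)
  have he : p / (p + (σ - 1)) * (x / p) + (σ - 1) / (p + (σ - 1)) * 1
      = (x + (σ - 1)) / (p + (σ - 1)) := by field_simp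
  simp only [smul_eq_mul, Real.log_one, mul_zero, add_zero] at hc
  rw [he, Real.log_div hx.ne' hp.ne', Real.log_div hd'.ne' hd.ne'] at hc
  rw [Real.log_div hd'.ne' (by linarith), Real.log_div hd.ne' (by linarith)]
  linarith

/-- Pointwise form of "Hellinger is at most relative entropy": apply `log u ≤ u - 1` to `u = √b /
√a`. -/
theorem sq_sqrt_sub_sqrt_le {a b : ℝ} (ha : 0 < a) (hb : 0 < b) :
    (√a - √b) ^ 2 ≤ a * (Real.log a - Real.log b) - a + b := by
  have hra := Real.sqrt_pos.2 ha
  have hrb := Real.sqrt_pos.2 hb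
  have h := Real.log_le_sub_one_of_pos (div_pos hrb hra)
  rw [Real.log_div hrb.ne' hra.ne', Real.log_sqrt ha.le, Real.log_sqrt hb.le] at h
  have h2 := mul_le_mul_of_nonneg_left h ha.le
  have h3 : a * (√b / √a - 1) = √a * √b - a := by
    nth_rewrite 1 [← Real.mul_self_sqrt ha.le]
    field_simp
    rw [mul_sub, Real.mul_self_sqrt ha.le]
  rw [h3] at h2
  nlinarith [Real.mul_self_sqrt ha.le, Real.mul_self_sqrt hb.le]

/-- The relative entropy density `x log x - x + 1`. -/
noncomputable def entropyDensity (x : ℝ) : ℝ := x * Real.log x - x + 1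

theorem sq_sqrt_sub_one_le {x : ℝ} (hx : 0 < x) : (√x - 1) ^ 2 ≤ entropyDensity x := by
  have := sq_sqrt_sub_sqrt_le hx one_pos
  simpa [entropyDensity] using this

/-- Jensen for the entropy density with its defect kept. With `D(a, b) = a log (a / b) - a + b`, the
defect is exactly `D(x, y) + (σ - 1) D(1, y)`; each divergence dominates a squared difference of
square roots, and the parallelogram law removes `y`. -/
theorem entropyDensity_affine_le {σ x : ℝ} (hσ : 2 ≤ σ) (hx : 0 < x) :
    entropyDensity ((x + (σ - 1)) / σ)
      ≤ entropyDensity x / σ - (√x - 1) ^ 2 / (2 * σ) := by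
  have hσ0 : 0 < σ := by linarith
  set y := (x + (σ - 1)) / σ with hy
  have hy0 : 0 < y := div_pos (by linarith) hσ0
  have h1 := sq_sqrt_sub_sqrt_le hx hy0
  have h2 := sq_sqrt_sub_sqrt_le one_pos hy0
  rw [Real.sqrt_one, Real.log_one] at h2
  have hyx : σ * y = x + (σ - 1) := by rw [hy]; field_simp
  have h2' := mul_le_mul_of_nonneg_left h2 (show (0 : ℝ) ≤ σ - 1 by linarith)
  have h3 : σ * entropyDensity y
      = entropyDensity x - (x * (Real.log x - Real.log y) - x + y)
        - (σ - 1) * (1 * (0 - Real.log y) - 1 + y) := by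
    unfold entropyDensity
    linear_combination (Real.log y) * hyx
  have h4 : σ * entropyDensity y ≤ entropyDensity x - (√x - 1) ^ 2 / 2 := by
    nlinarith [sq_nonneg (√x + 1 - 2 * √y), mul_nonneg (show (0 : ℝ) ≤ σ - 2 by linarith)
      (sq_nonneg (1 - √y))]
  rw [← sub_nonneg] at h4 ⊢
  have : entropyDensity x / σ - (√x - 1) ^ 2 / (2 * σ) - entropyDensity y
      = (entropyDensity x - (√x - 1) ^ 2 / 2 - σ * entropyDensity y) / σ := by field_simp
  rw [this]
  exact div_nonneg h4 hσ0.le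

/-- The right-hand side is a product of the Hellinger integrand's root and that of `x log² x`, ready
for Cauchy-Schwarz. It comes from `entropyDensity x ≤ (x - 1) log x` and `x - 1 = (√x - 1) (√x +
1)`. -/
theorem entropyDensity_le {x : ℝ} (hx : 1 / 4 ≤ x) :
    entropyDensity x ≤ 3 * (|√x - 1| * (√x * |Real.log x|)) := by
  have hx0 : 0 < x := by linarith
  have hr := Real.sqrt_nonneg x
  have hr2 : 1 / 2 ≤ √x := by
    rw [Real.le_sqrt (by norm_num) hx0.le]; linarith
  have h1 : entropyDensity x ≤ (x - 1) * Real.log x := by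
    have := Real.log_le_sub_one_of_pos hx0
    unfold entropyDensity; linarith
  refine h1.trans ((le_abs_self _).trans ?_)
  have h2 : x - 1 = (√x - 1) * (√x + 1) := by
    nlinarith [Real.mul_self_sqrt hx0.le]
  rw [abs_mul, h2, abs_mul, abs_of_nonneg (show 0 ≤ √x + 1 by linarith)]
  have h3 : √x + 1 ≤ 3 * √x := by linarith
  have h4 := mul_nonneg (abs_nonneg (√x - 1)) (abs_nonneg (Real.log x))
  nlinarith [mul_le_mul_of_nonneg_left h3 h4]

theorem sub_one_sub_log_le {x : ℝ} (hx : 1 / 2 ≤ x) :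
    x - 1 - Real.log x ≤ 6 * (√x - 1) ^ 2 := by
  have hx0 : 0 < x := by linarith
  have h1 := Real.one_sub_inv_le_log_of_pos hx0
  have hr : 7 / 10 ≤ √x := by
    rw [Real.le_sqrt (by norm_num) hx0.le]; linarith
  have hs := Real.mul_self_sqrt hx0.le
  refine (show x - 1 - Real.log x ≤ x - 2 + x⁻¹ by linarith).trans ?_
  have h2 : x - 2 + x⁻¹ = (√x - 1) ^ 2 * (√x + 1) ^ 2 / x := by
    have : (√x - 1) ^ 2 * (√x + 1) ^ 2 = (x - 1) ^ 2 := by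
      rw [← mul_pow]; congr 1; nlinarith
    rw [this]; field_simp; ring
  rw [h2, div_le_iff₀ hx0]
  have h3 : (√x + 1) ^ 2 ≤ 6 * x := by nlinarith
  nlinarith [mul_le_mul_of_nonneg_left h3 (sq_nonneg (√x - 1))]

theorem abs_log_le {x : ℝ} (hx : 1 / 2 ≤ x) : |Real.log x| ≤ 1 + x := by
  have hx0 : 0 < x := by linarith
  rw [abs_le]
  constructor
  · have h1 := Real.one_sub_inv_le_log_of_pos hx0
    have : x⁻¹ ≤ 2 := by
      rw [inv_le_comm₀ hx0 two_pos]; linarith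
    linarith
  · have := Real.log_le_sub_one_of_pos hx0
    linarith

/-- The leading coefficient has to be exactly `1 / σ`: it cancels the factor `s` produced by the
product, so that the logarithmic moment grows only additively. The remainder uses `log² x ≤ 4 x` for
`x ≥ 1`. -/
theorem affine_mul_sq_log_le {σ x : ℝ} (hσ : 2 ≤ σ) (hx : 0 < x) :
    (x + (σ - 1)) / σ * Real.log ((x + (σ - 1)) / σ) ^ 2
      ≤ x * Real.log x ^ 2 / σ + 4 * x + 1 := by
  have hσ0 : 0 < σ := by linarith
  set y := (x + (σ - 1)) / σ with hy
  have hy0 : 0 < y := div_pos (by linarith) hσ0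
  rcases le_total x 1 with h1 | h1
  · have hy1 : y ≤ 1 := by rw [hy, div_le_one hσ0]; linarith
    have hy2 : 1 / 2 ≤ y := by rw [hy, le_div_iff₀ hσ0]; linarith
    have hl := Real.log_nonpos hy0.le hy1
    have hl2 := Real.one_sub_inv_le_log_of_pos hy0
    have : y⁻¹ ≤ 2 := by
      rw [inv_le_comm₀ hy0 two_pos]; linarith
    have h3 : Real.log y ^ 2 ≤ 1 := by nlinarith
    have h4 : y * Real.log y ^ 2 ≤ 1 := by nlinarith [sq_nonneg (Real.log y)]
    have h5 : 0 ≤ x * Real.log x ^ 2 / σ := by positivity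
    linarith
  · have hy1 : 1 ≤ y := by rw [hy, le_div_iff₀ hσ0]; linarith
    have hyx : y ≤ x := by rw [hy, div_le_iff₀ hσ0]; nlinarith
    have hl := Real.log_nonneg hy1
    have hl2 := Real.log_le_log hy0 hyx
    have h3 : Real.log y ^ 2 ≤ Real.log x ^ 2 := pow_le_pow_left₀ hl hl2 2
    have h4 : Real.log x ^ 2 ≤ 4 * x := by
      have h5 := Real.log_le_sub_one_of_pos (Real.sqrt_pos.2 hx)
      rw [Real.log_sqrt hx.le] at h5
      have h6 : Real.log x ≤ 2 * √x := by linarith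
      have h7 := pow_le_pow_left₀ (hl.trans hl2) h6 2
      rw [mul_pow, Real.sq_sqrt hx.le] at h7
      linarith
    have h8 : y = x / σ + (σ - 1) / σ := by rw [hy]; ring
    have h9 : (σ - 1) / σ ≤ 1 := by rw [div_le_one hσ0]; linarith
    calc y * Real.log y ^ 2 ≤ y * Real.log x ^ 2 := by gcongr
      _ = x * Real.log x ^ 2 / σ + (σ - 1) / σ * Real.log x ^ 2 := by rw [h8]; ring
      _ ≤ x * Real.log x ^ 2 / σ + 1 * Real.log x ^ 2 := by gcongr
      _ ≤ _ := by linarith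

/-- The Bregman divergence of `x ↦ x ^ (1 + θ)` decreases under translations. -/
theorem bregman_rpow_translate_le {θ a b c : ℝ} (hθ : 0 ≤ θ) (hθ1 : θ ≤ 1) (ha : 0 < a)
    (hb : 0 < b) (hc : 0 ≤ c) :
    (a + c) ^ (1 + θ) - (b + c) ^ (1 + θ) - (1 + θ) * (b + c) ^ θ * (a - b)
      ≤ a ^ (1 + θ) - b ^ (1 + θ) - (1 + θ) * b ^ θ * (a - b) := by
  have hder : ∀ t : ℝ, 0 ≤ t → HasDerivAt
      (fun t => (a + t) ^ (1 + θ) - (b + t) ^ (1 + θ) - (1 + θ) * (b + t) ^ θ * (a - b))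
      ((1 + θ) * ((a + t) ^ θ - (b + t) ^ θ - θ * (b + t) ^ (θ - 1) * (a - b))) t := by
    intro t ht
    have h1 : HasDerivAt (fun t => a + t) 1 t := by simpa using (hasDerivAt_id t).const_add a
    have h2 : HasDerivAt (fun t => b + t) 1 t := by simpa using (hasDerivAt_id t).const_add b
    have ha' : a + t ≠ 0 := by positivity
    have hb' : b + t ≠ 0 := by positivity
    have := ((h1.rpow_const (p := 1 + θ) (Or.inl ha')).sub
      (h2.rpow_const (p := 1 + θ) (Or.inl hb'))).sub
      (((h2.rpow_const (p := θ) (Or.inl hb')).const_mul (1 + θ)).mul_const (a - b))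
    convert! this using 1
    rw [show 1 + θ - 1 = θ by ring]
    ring
  have hanti : AntitoneOn
      (fun t => (a + t) ^ (1 + θ) - (b + t) ^ (1 + θ) - (1 + θ) * (b + t) ^ θ * (a - b))
      (Set.Ici 0) := by
    refine antitoneOn_of_deriv_nonpos (convex_Ici 0)
      (fun t ht => (hder t ht).continuousAt.continuousWithinAt)
      (fun t ht => ?_) (fun t ht => ?_)
    · rw [interior_Ici] at ht
      exact (hder t (le_of_lt ht)).differentiableAt.differentiableWithinAt
    · rw [interior_Ici] at ht
      have ht' : (0 : ℝ) < t := ht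
      rw [(hder t ht'.le).deriv]
      refine mul_nonpos_of_nonneg_of_nonpos (by linarith) ?_
      have hA : 0 < a + t := by positivity
      have hB : 0 < b + t := by positivity
      -- The derivative in `t` is a concave function minus its tangent line, that is Bernoulli's
      -- inequality for the exponent `θ ≤ 1`.
      have hber := rpow_one_add_le_one_add_mul_self (s := (a + t) / (b + t) - 1)
        (by have := div_pos hA hB; linarith) hθ hθ1
      rw [add_sub_cancel, Real.div_rpow hA.le hB.le, div_le_iff₀ (Real.rpow_pos_of_pos hB θ)]
        at hber
      rw [Real.rpow_sub_one hB.ne']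
      have : (1 + θ * ((a + t) / (b + t) - 1)) * (b + t) ^ θ
          = (b + t) ^ θ + θ * ((b + t) ^ θ / (b + t)) * (a - b) := by
        field_simp; ring
      linarith
  have := hanti (Set.mem_Ici.2 le_rfl) (Set.mem_Ici.2 hc) hc
  simpa using this

/-- The affine map is a dilation by `1 / σ` followed by a translation, and it fixes the base point
`1`. Homogeneity of the Bregman divergence gives the factor `σ ^ (-(1 + θ))`, and the translation
only decreases it. -/
theorem bregman_rpow_affine_le {θ σ x : ℝ} (hθ : 0 ≤ θ) (hθ1 : θ ≤ 1) (hσ : 1 ≤ σ)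
    (hx : 0 < x) :
    ((x + (σ - 1)) / σ) ^ (1 + θ) - 1 - (1 + θ) * ((x + (σ - 1)) / σ - 1)
      ≤ σ ^ (-(1 + θ)) * (x ^ (1 + θ) - 1 - (1 + θ) * (x - 1)) := by
  have hσ0 : 0 < σ := by linarith
  have h := bregman_rpow_translate_le hθ hθ1 (a := x / σ) (b := 1 / σ) (c := 1 - 1 / σ)
    (by positivity) (by positivity) (by rw [sub_nonneg, div_le_one hσ0]; exact hσ)
  have e1 : x / σ + (1 - 1 / σ) = (x + (σ - 1)) / σ := by field_simp
  have e2 : 1 / σ + (1 - 1 / σ) = 1 := by ring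
  rw [e1, e2, Real.one_rpow, Real.one_rpow, Real.div_rpow hx.le hσ0.le,
    Real.div_rpow one_pos.le hσ0.le, Real.div_rpow one_pos.le hσ0.le, Real.one_rpow,
    Real.one_rpow] at h
  have e3 : σ ^ (-(1 + θ)) * (x ^ (1 + θ) - 1 - (1 + θ) * (x - 1))
      = x ^ (1 + θ) / σ ^ (1 + θ) - 1 / σ ^ (1 + θ)
        - (1 + θ) * (1 / σ ^ θ) * (x / σ - 1 / σ) := by
    have hp := Real.rpow_pos_of_pos hσ0 θ
    rw [Real.rpow_neg hσ0.le, Real.rpow_add hσ0, Real.rpow_one]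
    field_simp
  rw [e3]
  refine le_trans (le_of_eq ?_) h
  field_simp
  ring

theorem add_mul_log_le_rpow {θ x : ℝ} (hx : 0 < x) :
    x + θ * (x * Real.log x) ≤ x ^ (1 + θ) := by
  rw [Real.rpow_add hx, Real.rpow_one, Real.rpow_def_of_pos hx θ]
  have := Real.add_one_le_exp (Real.log x * θ)
  nlinarith [mul_le_mul_of_nonneg_left this hx.le]

theorem exp_le_one_add_add_sq (a : ℝ) : Real.exp a ≤ 1 + a + a ^ 2 * (1 + Real.exp a) := by
  have h1 : Real.exp a - 1 ≤ a * Real.exp a := by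
    have h := Real.add_one_le_exp (-a)
    rw [Real.exp_neg] at h
    have h2 := mul_le_mul_of_nonneg_right h (Real.exp_pos a).le
    rw [inv_mul_cancel₀ (Real.exp_pos a).ne'] at h2
    linarith
  have h0 := Real.exp_pos a
  have h2 := Real.add_one_le_exp a
  rcases le_total 0 a with ha | ha
  · nlinarith [mul_le_mul_of_nonneg_left h1 ha, sq_nonneg a]
  · nlinarith [mul_le_mul_of_nonneg_left h2 (neg_nonneg.2 ha), sq_nonneg a,
      mul_nonneg (sq_nonneg a) h0.le]

/-- Second-order expansion in `θ`, with a polynomial remainder so that it is integrable uniformly in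
`θ ∈ [0, 1]`. -/
theorem rpow_le_add_mul_log {θ x : ℝ} (hθ : 0 ≤ θ) (hθ1 : θ ≤ 1) (hx : 1 / 2 ≤ x) :
    x ^ (1 + θ) ≤ x + θ * (x * Real.log x) + θ ^ 2 * (x * (1 + x) ^ 2 * (2 + x)) := by
  have hx0 : 0 < x := by linarith
  have h1 := exp_le_one_add_add_sq (Real.log x * θ)
  rw [← Real.rpow_def_of_pos hx0 θ] at h1
  have h2 : x ^ θ ≤ 1 + x := by
    rcases le_total x 1 with h | h
    · have := Real.rpow_le_one hx0.le h hθ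
      linarith
    · have := Real.rpow_le_rpow_of_exponent_le h hθ1
      rw [Real.rpow_one] at this
      linarith
  have h3 : Real.log x ^ 2 ≤ (1 + x) ^ 2 := by
    rw [← sq_abs]
    exact pow_le_pow_left₀ (abs_nonneg _) (abs_log_le hx) 2
  have h4 : (Real.log x * θ) ^ 2 * (1 + x ^ θ) ≤ θ ^ 2 * ((1 + x) ^ 2 * (2 + x)) := by
    rw [mul_pow, mul_comm (Real.log x ^ 2), mul_assoc]
    have hp : 0 ≤ x ^ θ := Real.rpow_nonneg hx0.le θ
    have h5 : 1 + x ^ θ ≤ 2 + x := by linarith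
    gcongr
  rw [Real.rpow_add hx0, Real.rpow_one]
  have h5 := mul_le_mul_of_nonneg_left (h1.trans (add_le_add le_rfl h4)) hx0.le
  linarith

end HierarchicalPinning

/-! ### One-step estimates for entropy, Hellinger distance and moments. -/

namespace HierarchicalPinning

section

variable {Ω : Type*} {s : ℕ} {X : ℕ → Ω → ℝ}

/-- The product of the children of the vertex `1`. -/
noncomputable def childProd (s : ℕ) (X : ℕ → Ω → ℝ) (x : Ω) : ℝ :=
  ∏ j ∈ Finset.Icc 1 s, X (s * 1 + j) x

theorem step_one (x : Ω) : step s X 1 x = (childProd s X x + ((s : ℝ) - 1)) / s := rfl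

theorem half_le_step (hs : 2 ≤ s) (hpos : ∀ i x, 0 < X i x) (i : ℕ) (x : Ω) :
    1 / 2 ≤ step s X i x := by
  have hs2 : (2 : ℝ) ≤ s := by exact_mod_cast hs
  have h := Finset.prod_pos (s := Finset.Icc 1 s) fun j _ => hpos (s * i + j) x
  unfold step
  rw [le_div_iff₀ (by linarith)]
  linarith

theorem childProd_pos (hpos : ∀ i x, 0 < X i x) (x : Ω) : 0 < childProd s X x :=
  Finset.prod_pos fun _ _ => hpos _ _

theorem log_childProd (hpos : ∀ i x, 0 < X i x) (x : Ω) :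
    Real.log (childProd s X x) = ∑ j ∈ Finset.Icc 1 s, Real.log (X (s * 1 + j) x) :=
  Real.log_prod fun _ _ => (hpos _ _).ne'

variable [MeasurableSpace Ω] {μ : Measure Ω}

/-- The mean of the common law of the family. -/
noncomputable def mean (μ : Measure Ω) (X : ℕ → Ω → ℝ) : ℝ := ∫ x, X 1 x ∂μ

/-- The mean of the logarithm. -/
noncomputable def logMean (μ : Measure Ω) (X : ℕ → Ω → ℝ) : ℝ := ∫ x, Real.log (X 1 x) ∂μ

/-- The relative entropy functional. -/
noncomputable def entropy (μ : Measure Ω) (X : ℕ → Ω → ℝ) : ℝ := ∫ x, entropyDensity (X 1 x) ∂μ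

/-- The squared Hellinger distance functional. -/
noncomputable def hellinger (μ : Measure Ω) (X : ℕ → Ω → ℝ) : ℝ := ∫ x, (√(X 1 x) - 1) ^ 2 ∂μ

/-- The second logarithmic moment under the size-biased law. -/
noncomputable def sqLogMoment (μ : Measure Ω) (X : ℕ → Ω → ℝ) : ℝ :=
  ∫ x, X 1 x * Real.log (X 1 x) ^ 2 ∂μ

/-- The moment of order `1 + θ`. -/
noncomputable def rpowMoment (μ : Measure Ω) (X : ℕ → Ω → ℝ) (θ : ℝ) : ℝ :=
  ∫ x, X 1 x ^ (1 + θ) ∂μ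

namespace IsIIDPos

theorem integrable_comp (hX : IsIIDPos μ X) {f : ℝ → ℝ} (hf : Measurable f) (C : ℝ) (p : ℕ)
    (hb : ∀ x, |f (X 1 x)| ≤ C * (1 + X 1 x ^ p)) : Integrable (fun x => f (X 1 x)) μ := by
  have := hX.indep.isProbabilityMeasure
  exact (((integrable_const (1 : ℝ)).fun_add (hX.moments p)).const_mul C).mono'
    (hf.comp (hX.meas 1)).aestronglyMeasurable (ae_of_all _ hb)

theorem integrable_id (hX : IsIIDPos μ X) : Integrable (X 1) μ := by
  simpa using hX.moments 1

theorem integrable_log (hX : IsIIDPos μ X) (hH : ∀ i x, 1 / 2 ≤ X i x) :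
    Integrable (fun x => Real.log (X 1 x)) μ :=
  hX.integrable_comp Real.measurable_log 1 1 fun x => by
    have := abs_log_le (hH 1 x); linarith

theorem integrable_log_apply (hX : IsIIDPos μ X) (hH : ∀ i x, 1 / 2 ≤ X i x) (i : ℕ) :
    Integrable (fun x => Real.log (X i x)) μ :=
  (((hX.ident i).comp Real.measurable_log).integrable_iff).2 (hX.integrable_log hH)

theorem integral_log_apply (hX : IsIIDPos μ X) (i : ℕ) :
    ∫ x, Real.log (X i x) ∂μ = logMean μ X :=
  ((hX.ident i).comp Real.measurable_log).integral_eq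

theorem integrable_mul_log (hX : IsIIDPos μ X) (hH : ∀ i x, 1 / 2 ≤ X i x) :
    Integrable (fun x => X 1 x * Real.log (X 1 x)) μ :=
  hX.integrable_comp (f := fun y => y * Real.log y) (by fun_prop) 2 2 fun x => by
    have h := abs_log_le (hH 1 x)
    have h0 := hX.pos 1 x
    rw [abs_mul, abs_of_pos h0]
    nlinarith [mul_le_mul_of_nonneg_left h h0.le, sq_nonneg (X 1 x - 1)]

theorem integrable_mul_sq_log (hX : IsIIDPos μ X) (hH : ∀ i x, 1 / 2 ≤ X i x) :
    Integrable (fun x => X 1 x * Real.log (X 1 x) ^ 2) μ :=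
  hX.integrable_comp (f := fun y => y * Real.log y ^ 2) (by fun_prop) 4 3 fun x => by
    have h := abs_log_le (hH 1 x)
    have h0 := hX.pos 1 x
    rw [abs_mul, abs_of_pos h0, abs_pow]
    have h2 := pow_le_pow_left₀ (abs_nonneg _) h 2
    have h3 := mul_le_mul_of_nonneg_left h2 h0.le
    nlinarith [mul_nonneg h0.le (sq_nonneg (X 1 x - 1)), sq_nonneg (X 1 x - 1)]

theorem integrable_sqrt (hX : IsIIDPos μ X) : Integrable (fun x => √(X 1 x)) μ :=
  hX.integrable_comp (f := fun y => √y) (by fun_prop) 1 1 fun x => by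
    rw [abs_of_nonneg (Real.sqrt_nonneg _)]
    nlinarith [Real.mul_self_sqrt (hX.pos 1 x).le, sq_nonneg (√(X 1 x) - 1)]

theorem integrable_rpow (hX : IsIIDPos μ X) {θ : ℝ} (hθ : 0 ≤ θ) (hθ1 : θ ≤ 1) :
    Integrable (fun x => X 1 x ^ (1 + θ)) μ :=
  hX.integrable_comp (f := fun y => y ^ (1 + θ)) (by fun_prop) 1 2 fun x => by
    have h0 := hX.pos 1 x
    rw [abs_of_nonneg (Real.rpow_nonneg h0.le _), one_mul]
    rcases le_total (X 1 x) 1 with h | h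
    · have := Real.rpow_le_one h0.le h (show 0 ≤ 1 + θ by linarith)
      nlinarith [sq_nonneg (X 1 x)]
    · have := Real.rpow_le_rpow_of_exponent_le h (show 1 + θ ≤ (2 : ℕ) by push_cast; linarith)
      rw [Real.rpow_natCast] at this
      linarith

theorem integrable_entropyDensity (hX : IsIIDPos μ X) (hH : ∀ i x, 1 / 2 ≤ X i x) :
    Integrable (fun x => entropyDensity (X 1 x)) μ := by
  have := hX.indep.isProbabilityMeasure
  exact ((hX.integrable_mul_log hH).sub' hX.integrable_id).fun_add (integrable_const 1)

theorem integrable_hellinger (hX : IsIIDPos μ X) :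
    Integrable (fun x => (√(X 1 x) - 1) ^ 2) μ := by
  have := hX.indep.isProbabilityMeasure
  have h := (hX.integrable_id.sub' (hX.integrable_sqrt.const_mul 2)).fun_add (integrable_const (1 : ℝ))
  refine h.congr (ae_of_all _ fun x => ?_)
  nlinarith [Real.mul_self_sqrt (hX.pos 1 x).le]

theorem entropy_eq (hX : IsIIDPos μ X) (hH : ∀ i x, 1 / 2 ≤ X i x) (hm : mean μ X = 1) :
    entropy μ X = ∫ x, X 1 x * Real.log (X 1 x) ∂μ := by
  have := hX.indep.isProbabilityMeasure
  unfold entropy entropyDensity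
  rw [integral_add ((hX.integrable_mul_log hH).sub' hX.integrable_id) (integrable_const _),
    integral_sub (hX.integrable_mul_log hH) hX.integrable_id]
  unfold mean at hm
  rw [hm]; simp

theorem hellinger_eq (hX : IsIIDPos μ X) (hm : mean μ X = 1) :
    hellinger μ X = 2 - 2 * ∫ x, √(X 1 x) ∂μ := by
  have := hX.indep.isProbabilityMeasure
  unfold hellinger
  have h : ∀ x, (√(X 1 x) - 1) ^ 2 = X 1 x - 2 * √(X 1 x) + 1 := fun x => by
    nlinarith [Real.mul_self_sqrt (hX.pos 1 x).le]
  simp_rw [h]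
  rw [integral_add (hX.integrable_id.sub' (hX.integrable_sqrt.const_mul 2)) (integrable_const _),
    integral_sub hX.integrable_id (hX.integrable_sqrt.const_mul 2), integral_const_mul]
  unfold mean at hm
  rw [hm]; simp; ring

theorem integrable_childProd (hX : IsIIDPos μ X) : Integrable (childProd s X) μ :=
  hX.integrable_prod_children 1 (g := fun _ y => y) (fun _ => measurable_id)
    fun _ => hX.integrable_id

theorem integral_childProd (hX : IsIIDPos μ X) :
    ∫ x, childProd s X x ∂μ = mean μ X ^ s := by
  have := hX.integral_prod_children (s := s) 1 (g := fun _ y => y) (fun _ => measurable_id)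
  unfold childProd
  rw [this]; simp [mean]

theorem mean_step (hX : IsIIDPos μ X) : mean μ (HierarchicalPinning.step s X)
    = (mean μ X ^ s + ((s : ℝ) - 1)) / s := by
  have := hX.indep.isProbabilityMeasure
  unfold mean
  simp_rw [step_one]
  rw [integral_div, integral_add hX.integrable_childProd (integrable_const _),
    hX.integral_childProd]
  simp [mean]

theorem integrable_sqrt_childProd (hX : IsIIDPos μ X) :
    Integrable (fun x => √(childProd s X x)) μ := by
  have := hX.integrable_prod_children (s := s) 1 (g := fun _ y => √y) (fun _ => by fun_prop)
    fun _ => hX.integrable_sqrt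
  refine this.congr (ae_of_all _ fun x => ?_)
  exact (Real.sqrt_prod _ fun j _ => (hX.pos _ x).le).symm

theorem integral_sqrt_childProd (hX : IsIIDPos μ X) :
    ∫ x, √(childProd s X x) ∂μ = (∫ x, √(X 1 x) ∂μ) ^ s := by
  have := hX.integral_prod_children (s := s) 1 (g := fun _ y => √y) (fun _ => by fun_prop)
  rw [Finset.prod_const, Nat.card_Icc, Nat.add_sub_cancel] at this
  rw [← this]
  congr 1; funext x
  exact Real.sqrt_prod _ fun j _ => (hX.pos _ x).le

theorem integrable_rpow_childProd (hX : IsIIDPos μ X) {θ : ℝ} (hθ : 0 ≤ θ) (hθ1 : θ ≤ 1) :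
    Integrable (fun x => childProd s X x ^ (1 + θ)) μ := by
  have := hX.integrable_prod_children (s := s) 1 (g := fun _ y => y ^ (1 + θ))
    (fun _ => by fun_prop) fun _ => hX.integrable_rpow hθ hθ1
  refine this.congr (ae_of_all _ fun x => ?_)
  exact Real.finsetProd_rpow _ _ (fun j _ => (hX.pos _ x).le) _

theorem integral_rpow_childProd (hX : IsIIDPos μ X) (θ : ℝ) :
    ∫ x, childProd s X x ^ (1 + θ) ∂μ = rpowMoment μ X θ ^ s := by
  have := hX.integral_prod_children (s := s) 1 (g := fun _ y => y ^ (1 + θ))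
    (fun _ => by fun_prop)
  rw [Finset.prod_const, Nat.card_Icc, Nat.add_sub_cancel] at this
  rw [rpowMoment, ← this]
  congr 1; funext x
  exact (Real.finsetProd_rpow _ _ (fun j _ => (hX.pos _ x).le) _).symm

theorem integrable_log_childProd (hX : IsIIDPos μ X) (hH : ∀ i x, 1 / 2 ≤ X i x) :
    Integrable (fun x => Real.log (childProd s X x)) μ := by
  simp_rw [log_childProd hX.pos]
  exact integrable_finsetSum _ fun j _ => hX.integrable_log_apply hH (s * 1 + j)

theorem integral_log_childProd (hX : IsIIDPos μ X) (hH : ∀ i x, 1 / 2 ≤ X i x) :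
    ∫ x, Real.log (childProd s X x) ∂μ = s * logMean μ X := by
  simp_rw [log_childProd hX.pos]
  rw [integral_finsetSum _ fun j _ => hX.integrable_log_apply hH (s * 1 + j)]
  have : ∀ j ∈ Finset.Icc 1 s, ∫ x, Real.log (X (s * 1 + j) x) ∂μ = logMean μ X := fun j _ =>
    hX.integral_log_apply (s * 1 + j)
  rw [Finset.sum_congr rfl this]; simp

/-- Written as a sum of products of functions of single children, so that independence factorizes
each term. -/
theorem childProd_mul_log (hX : IsIIDPos μ X) (x : Ω) :
    childProd s X x * Real.log (childProd s X x) = ∑ k ∈ Finset.Icc 1 s,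
      ∏ j ∈ Finset.Icc 1 s, X (s * 1 + j) x * (if j = k then Real.log (X (s * 1 + j) x) else 1) := by
  rw [log_childProd hX.pos, Finset.mul_sum]
  refine Finset.sum_congr rfl fun k hk => ?_
  rw [Finset.prod_mul_distrib, Finset.prod_ite_eq' , if_pos hk]; rfl

theorem childProd_mul_sq_log (hX : IsIIDPos μ X) (x : Ω) :
    childProd s X x * Real.log (childProd s X x) ^ 2 =
      ∑ k ∈ Finset.Icc 1 s, ∑ l ∈ Finset.Icc 1 s, ∏ j ∈ Finset.Icc 1 s, X (s * 1 + j) x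
        * ((if j = k then Real.log (X (s * 1 + j) x) else 1)
          * (if j = l then Real.log (X (s * 1 + j) x) else 1)) := by
  rw [log_childProd hX.pos, sq, Finset.sum_mul_sum, Finset.mul_sum]
  refine Finset.sum_congr rfl fun k hk => ?_
  rw [Finset.mul_sum]
  refine Finset.sum_congr rfl fun l hl => ?_
  rw [Finset.prod_mul_distrib, Finset.prod_mul_distrib, Finset.prod_ite_eq', if_pos hk,
    Finset.prod_ite_eq', if_pos hl]; rfl

theorem integrable_mul_ite (hX : IsIIDPos μ X) (hH : ∀ i x, 1 / 2 ≤ X i x) (j k : ℕ) :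
    Integrable (fun x => X 1 x * (if j = k then Real.log (X 1 x) else 1)) μ := by
  split_ifs
  · exact hX.integrable_mul_log hH
  · simpa using hX.integrable_id

theorem integrable_mul_ite_mul_ite (hX : IsIIDPos μ X) (hH : ∀ i x, 1 / 2 ≤ X i x)
    (j k l : ℕ) :
    Integrable (fun x => X 1 x * ((if j = k then Real.log (X 1 x) else 1)
      * (if j = l then Real.log (X 1 x) else 1))) μ := by
  split_ifs
  · simpa [sq] using hX.integrable_mul_sq_log hH
  · simpa using hX.integrable_mul_log hH
  · simpa using hX.integrable_mul_log hH
  · simpa using hX.integrable_id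

theorem integrable_childProd_mul_log (hX : IsIIDPos μ X) (hH : ∀ i x, 1 / 2 ≤ X i x) :
    Integrable (fun x => childProd s X x * Real.log (childProd s X x)) μ := by
  simp_rw [hX.childProd_mul_log]
  exact integrable_finsetSum _ fun k _ => hX.integrable_prod_children 1
    (g := fun j y => y * (if j = k then Real.log y else 1))
    (fun j => by split_ifs <;> fun_prop) fun j => hX.integrable_mul_ite hH j k

theorem integrable_childProd_mul_sq_log (hX : IsIIDPos μ X) (hH : ∀ i x, 1 / 2 ≤ X i x) :
    Integrable (fun x => childProd s X x * Real.log (childProd s X x) ^ 2) μ := by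
  simp_rw [hX.childProd_mul_sq_log]
  exact integrable_finsetSum _ fun k _ => integrable_finsetSum _ fun l _ =>
    hX.integrable_prod_children 1
    (g := fun j y => y * ((if j = k then Real.log y else 1) * (if j = l then Real.log y else 1)))
    (fun j => by split_ifs <;> fun_prop) fun j => hX.integrable_mul_ite_mul_ite hH j k l

theorem integral_childProd_mul_log (hX : IsIIDPos μ X) (hH : ∀ i x, 1 / 2 ≤ X i x)
    (hm : mean μ X = 1) :
    ∫ x, childProd s X x * Real.log (childProd s X x) ∂μ = s * entropy μ X := by
  simp_rw [hX.childProd_mul_log]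
  have hmeas : ∀ k j : ℕ, Measurable (fun y : ℝ => y * (if j = k then Real.log y else 1)) :=
    fun k j => by split_ifs <;> fun_prop
  rw [integral_finsetSum _ fun k _ => hX.integrable_prod_children 1
    (g := fun j y => y * (if j = k then Real.log y else 1)) (hmeas k)
    fun j => hX.integrable_mul_ite hH j k]
  have : ∀ k ∈ Finset.Icc 1 s, ∫ x, ∏ j ∈ Finset.Icc 1 s, X (s * 1 + j) x
      * (if j = k then Real.log (X (s * 1 + j) x) else 1) ∂μ = entropy μ X := by
    intro k hk
    rw [hX.integral_prod_children 1
      (g := fun j y => y * (if j = k then Real.log y else 1)) (hmeas k)]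
    have h2 : ∀ j ∈ Finset.Icc 1 s, ∫ x, X 1 x * (if j = k then Real.log (X 1 x) else 1) ∂μ
        = if j = k then entropy μ X else 1 := by
      intro j _
      split_ifs
      · exact (hX.entropy_eq hH hm).symm
      · simpa [mean] using hm
    rw [Finset.prod_congr rfl h2, Finset.prod_ite_eq', if_pos hk]
  rw [Finset.sum_congr rfl this]; simp

theorem sqLogMoment_nonneg (hX : IsIIDPos μ X) : 0 ≤ sqLogMoment μ X :=
  integral_nonneg fun x => mul_nonneg (hX.pos 1 x).le (sq_nonneg _)

/-- Under the size-biased law the logarithms of the children are independent with mean `entropy μ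
X`: diagonal terms give `sqLogMoment μ X`, off-diagonal ones the squared entropy. The squared
entropy is also added on the diagonal, which only weakens the bound. -/
theorem integral_childProd_mul_sq_log_le (hX : IsIIDPos μ X) (hH : ∀ i x, 1 / 2 ≤ X i x)
    (hm : mean μ X = 1) :
    ∫ x, childProd s X x * Real.log (childProd s X x) ^ 2 ∂μ
      ≤ s * sqLogMoment μ X + s ^ 2 * entropy μ X ^ 2 := by
  simp_rw [hX.childProd_mul_sq_log]
  have hmeas : ∀ k l j : ℕ, Measurable (fun y : ℝ => y * ((if j = k then Real.log y else 1)
      * (if j = l then Real.log y else 1))) :=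
    fun k l j => by split_ifs <;> fun_prop
  have hint := fun k l : ℕ => hX.integrable_prod_children (s := s) 1
    (g := fun j y => y * ((if j = k then Real.log y else 1) * (if j = l then Real.log y else 1)))
    (hmeas k l) fun j => hX.integrable_mul_ite_mul_ite hH j k l
  rw [integral_finsetSum _ fun k _ => integrable_finsetSum _ fun l _ => hint k l]
  have hw := hX.sqLogMoment_nonneg
  have key : ∀ k ∈ Finset.Icc 1 s, ∀ l ∈ Finset.Icc 1 s,
      ∫ x, ∏ j ∈ Finset.Icc 1 s, X (s * 1 + j) x
        * ((if j = k then Real.log (X (s * 1 + j) x) else 1)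
          * (if j = l then Real.log (X (s * 1 + j) x) else 1)) ∂μ
      ≤ (if l = k then sqLogMoment μ X else 0) + entropy μ X ^ 2 := by
    intro k hk l hl
    rw [hX.integral_prod_children 1 (g := fun j y => y * ((if j = k then Real.log y else 1)
      * (if j = l then Real.log y else 1))) (hmeas k l)]
    rcases eq_or_ne l k with rfl | hlk
    · have h2 : ∀ j ∈ Finset.Icc 1 s, ∫ x, X 1 x * ((if j = l then Real.log (X 1 x) else 1)
          * (if j = l then Real.log (X 1 x) else 1)) ∂μ
          = if j = l then sqLogMoment μ X else 1 := by
        intro j _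
        split_ifs
        · simp [sqLogMoment, sq]
        · simpa [mean] using hm
      rw [Finset.prod_congr rfl h2, Finset.prod_ite_eq', if_pos hk, if_pos rfl]
      nlinarith [sq_nonneg (entropy μ X)]
    · have h2 : ∀ j ∈ Finset.Icc 1 s, ∫ x, X 1 x * ((if j = k then Real.log (X 1 x) else 1)
          * (if j = l then Real.log (X 1 x) else 1)) ∂μ
          = (if j = k then entropy μ X else 1) * (if j = l then entropy μ X else 1) := by
        intro j _
        split_ifs with h3 h4
        · exact absurd (h4.symm.trans h3) hlk
        · simpa using (hX.entropy_eq hH hm).symm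
        · simpa using (hX.entropy_eq hH hm).symm
        · simpa [mean] using hm
      rw [Finset.prod_congr rfl h2, Finset.prod_mul_distrib, Finset.prod_ite_eq', if_pos hk,
        Finset.prod_ite_eq', if_pos hl, if_neg hlk]
      nlinarith
  calc _ = ∑ k ∈ Finset.Icc 1 s, ∑ l ∈ Finset.Icc 1 s,
        ∫ x, ∏ j ∈ Finset.Icc 1 s, X (s * 1 + j) x
        * ((if j = k then Real.log (X (s * 1 + j) x) else 1)
          * (if j = l then Real.log (X (s * 1 + j) x) else 1)) ∂μ :=
        Finset.sum_congr rfl fun k _ => integral_finsetSum _ fun l _ => hint k l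
    _ ≤ ∑ k ∈ Finset.Icc 1 s, ∑ l ∈ Finset.Icc 1 s,
        ((if l = k then sqLogMoment μ X else 0) + entropy μ X ^ 2) :=
        Finset.sum_le_sum fun k hk => Finset.sum_le_sum fun l hl => key k hk l hl
    _ = ∑ k ∈ Finset.Icc 1 s, (sqLogMoment μ X + s * entropy μ X ^ 2) := by
        refine Finset.sum_congr rfl fun k hk => ?_
        rw [Finset.sum_add_distrib, Finset.sum_ite_eq', if_pos hk]; simp
    _ = _ := by simp; ring

theorem integral_sqrt_le_one (hX : IsIIDPos μ X) (hm : mean μ X = 1) :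
    ∫ x, √(X 1 x) ∂μ ≤ 1 := by
  have h := hX.hellinger_eq hm
  have : 0 ≤ hellinger μ X := integral_nonneg fun x => sq_nonneg _
  linarith

theorem hellinger_le_entropy (hX : IsIIDPos μ X) (hH : ∀ i x, 1 / 2 ≤ X i x) :
    hellinger μ X ≤ entropy μ X :=
  integral_mono hX.integrable_hellinger (hX.integrable_entropyDensity hH)
    fun x => sq_sqrt_sub_one_le (hX.pos 1 x)

theorem entropy_nonneg (hX : IsIIDPos μ X) (hH : ∀ i x, 1 / 2 ≤ X i x) : 0 ≤ entropy μ X :=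
  (integral_nonneg fun _ => sq_nonneg _ : 0 ≤ hellinger μ X).trans (hX.hellinger_le_entropy hH)

/-- Entropy is additive over independent factors, so the `s` gained in the product cancels the `1 /
s` of `entropyDensity_affine_le` and only the defect remains. The defect of the product is at least
that of one factor, since `(𝔼 √X) ^ s ≤ 𝔼 √X ≤ 1`. -/
theorem entropy_step_le (hX : IsIIDPos μ X) (hH : ∀ i x, 1 / 2 ≤ X i x) (hs : 2 ≤ s)
    (hm : mean μ X = 1) :
    entropy μ (HierarchicalPinning.step s X) ≤ entropy μ X - hellinger μ X / (2 * s) := by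
  have := hX.indep.isProbabilityMeasure
  have hs2 : (2 : ℝ) ≤ s := by exact_mod_cast hs
  have hs0 : (0 : ℝ) < s := by linarith
  have hH' := half_le_step hs hX.pos
  have hP : ∫ x, childProd s X x ∂μ = 1 := by rw [hX.integral_childProd, hm, one_pow]
  have hint2 : Integrable (fun x => (√(childProd s X x) - 1) ^ 2) μ := by
    refine (((hX.integrable_childProd (s := s)).sub'
      ((hX.integrable_sqrt_childProd (s := s)).const_mul 2)).fun_add (integrable_const (1 : ℝ))).congr
      (ae_of_all _ fun x => ?_)
    nlinarith [Real.mul_self_sqrt (childProd_pos (s := s) hX.pos x).le]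
  have hint1 : Integrable (fun x => entropyDensity (childProd s X x)) μ :=
    ((hX.integrable_childProd_mul_log hH).sub' hX.integrable_childProd).fun_add (integrable_const 1)
  have h1 : ∫ x, entropyDensity (childProd s X x) ∂μ = s * entropy μ X := by
    unfold entropyDensity
    rw [integral_add ((hX.integrable_childProd_mul_log hH).sub' hX.integrable_childProd)
      (integrable_const _), integral_sub (hX.integrable_childProd_mul_log hH)
      hX.integrable_childProd, hX.integral_childProd_mul_log hH hm, hP]
    simp
  have h2 : ∫ x, (√(childProd s X x) - 1) ^ 2 ∂μ = 2 - 2 * (∫ x, √(X 1 x) ∂μ) ^ s := by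
    have h : ∀ x, (√(childProd s X x) - 1) ^ 2
        = childProd s X x - 2 * √(childProd s X x) + 1 := fun x => by
      nlinarith [Real.mul_self_sqrt (childProd_pos (s := s) hX.pos x).le]
    simp_rw [h]
    rw [integral_add (hX.integrable_childProd.sub' (hX.integrable_sqrt_childProd.const_mul 2))
      (integrable_const _), integral_sub hX.integrable_childProd
      (hX.integrable_sqrt_childProd.const_mul 2), integral_const_mul,
      hX.integral_sqrt_childProd, hP]
    simp; ring
  have h3 : hellinger μ X ≤ ∫ x, (√(childProd s X x) - 1) ^ 2 ∂μ := by
    rw [h2, hX.hellinger_eq hm]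
    have h4 : (∫ x, √(X 1 x) ∂μ) ^ s ≤ ∫ x, √(X 1 x) ∂μ :=
      pow_le_of_le_one (integral_nonneg fun x => Real.sqrt_nonneg _)
        (hX.integral_sqrt_le_one hm) (by omega)
    linarith
  calc entropy μ (HierarchicalPinning.step s X)
      ≤ ∫ x, (entropyDensity (childProd s X x) / s
        - (√(childProd s X x) - 1) ^ 2 / (2 * s)) ∂μ := by
        refine integral_mono ((hX.step hs).integrable_entropyDensity hH')
          ((hint1.div_const _).sub' (hint2.div_const _)) fun x => ?_
        exact entropyDensity_affine_le hs2 (childProd_pos hX.pos x)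
    _ = entropy μ X - (∫ x, (√(childProd s X x) - 1) ^ 2 ∂μ) / (2 * s) := by
        rw [integral_sub (hint1.div_const _) (hint2.div_const _), integral_div, integral_div, h1]
        field_simp
    _ ≤ _ := by gcongr

theorem sqLogMoment_step_le (hX : IsIIDPos μ X) (hH : ∀ i x, 1 / 2 ≤ X i x) (hs : 2 ≤ s)
    (hm : mean μ X = 1) :
    sqLogMoment μ (HierarchicalPinning.step s X)
      ≤ sqLogMoment μ X + s * entropy μ X ^ 2 + 5 := by
  have := hX.indep.isProbabilityMeasure
  have hs2 : (2 : ℝ) ≤ s := by exact_mod_cast hs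
  have hs0 : (0 : ℝ) < s := by linarith
  have hP : ∫ x, childProd s X x ∂μ = 1 := by rw [hX.integral_childProd, hm, one_pow]
  have hi := hX.integrable_childProd_mul_sq_log (s := s) hH
  have hi2 := hX.integrable_childProd (s := s)
  calc sqLogMoment μ (HierarchicalPinning.step s X)
      ≤ ∫ x, (childProd s X x * Real.log (childProd s X x) ^ 2 / s
          + 4 * childProd s X x + 1) ∂μ := by
        refine integral_mono ((hX.step hs).integrable_mul_sq_log (half_le_step hs hX.pos))
          (((hi.div_const _).fun_add (hi2.const_mul 4)).fun_add (integrable_const _)) fun x => ?_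
        exact affine_mul_sq_log_le hs2 (childProd_pos hX.pos x)
    _ = (∫ x, childProd s X x * Real.log (childProd s X x) ^ 2 ∂μ) / s + 5 := by
        rw [integral_add ((hi.div_const _).fun_add (hi2.const_mul 4)) (integrable_const _),
          integral_add (hi.div_const _) (hi2.const_mul 4), integral_div, integral_const_mul, hP]
        simp; ring
    _ ≤ (s * sqLogMoment μ X + s ^ 2 * entropy μ X ^ 2) / s + 5 := by
        have := hX.integral_childProd_mul_sq_log_le (s := s) hH hm
        gcongr
    _ = _ := by field_simp

/-- Cauchy-Schwarz applied to `entropyDensity_le`, obtained from the sign of a discriminant. -/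
theorem sq_entropy_le (hX : IsIIDPos μ X) (hH : ∀ i x, 1 / 2 ≤ X i x) :
    entropy μ X ^ 2 ≤ 9 * (hellinger μ X * sqLogMoment μ X) := by
  have := hX.indep.isProbabilityMeasure
  have hd0 : 0 ≤ hellinger μ X := integral_nonneg fun x => sq_nonneg _
  have hw := hX.sqLogMoment_nonneg
  have he := hX.entropy_nonneg hH
  have key : ∀ t : ℝ, 2 * t * entropy μ X ≤ 3 * hellinger μ X + 3 * t ^ 2 * sqLogMoment μ X := by
    intro t
    rcases lt_or_ge t 0 with ht | ht
    · have : 2 * t * entropy μ X ≤ 0 := by nlinarith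
      have : 0 ≤ 3 * t ^ 2 * sqLogMoment μ X := by positivity
      linarith
    unfold entropy hellinger sqLogMoment
    rw [← integral_const_mul, ← integral_const_mul, ← integral_const_mul, ← integral_add
      (hX.integrable_hellinger.const_mul _) ((hX.integrable_mul_sq_log hH).const_mul _)]
    refine integral_mono ((hX.integrable_entropyDensity hH).const_mul _)
      ((hX.integrable_hellinger.const_mul _).fun_add ((hX.integrable_mul_sq_log hH).const_mul _))
      fun x => ?_
    have h1 := entropyDensity_le (show 1 / 4 ≤ X 1 x by have := hH 1 x; linarith)
    have h2 := mul_le_mul_of_nonneg_left h1 (show 0 ≤ 2 * t by linarith)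
    have h3 : X 1 x * Real.log (X 1 x) ^ 2 = (√(X 1 x) * |Real.log (X 1 x)|) ^ 2 := by
      rw [mul_pow, Real.sq_sqrt (hX.pos 1 x).le, sq_abs]
    rw [h3, ← sq_abs (√(X 1 x) - 1)]
    nlinarith [sq_nonneg (|√(X 1 x) - 1| - t * (√(X 1 x) * |Real.log (X 1 x)|))]
  have hdisc := discrim_le_zero (a := 3 * sqLogMoment μ X) (b := -(2 * entropy μ X))
    (c := 3 * hellinger μ X) fun t => by nlinarith [key t]
  unfold discrim at hdisc
  nlinarith

/-- Integrate `bregman_rpow_affine_le` at the product of the children; the linear terms vanish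
because both means equal `1`. -/
theorem rpowMoment_step_le (hX : IsIIDPos μ X) (hs : 2 ≤ s) (hm : mean μ X = 1) {θ : ℝ}
    (hθ : 0 ≤ θ) (hθ1 : θ ≤ 1) :
    rpowMoment μ (HierarchicalPinning.step s X) θ - 1
      ≤ (s : ℝ) ^ (-(1 + θ)) * (rpowMoment μ X θ ^ s - 1) := by
  have := hX.indep.isProbabilityMeasure
  have hs2 : (2 : ℝ) ≤ s := by exact_mod_cast hs
  have hP : ∫ x, childProd s X x ∂μ = 1 := by rw [hX.integral_childProd, hm, one_pow]
  have hm' : mean μ (HierarchicalPinning.step s X) = 1 := by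
    rw [hX.mean_step, hm]; field_simp; ring
  have hY := hX.step hs
  have hiY := hY.integrable_rpow hθ hθ1
  have hiP := hX.integrable_rpow_childProd (s := s) hθ hθ1
  have c1 : Integrable (fun _ : Ω => (1 : ℝ)) μ := integrable_const _
  have h1 := integral_mono
    ((hiY.sub' c1).sub' ((hY.integrable_id.sub' c1).const_mul (1 + θ)))
    (((hiP.sub' c1).sub' (((hX.integrable_childProd (s := s)).sub' c1).const_mul (1 + θ))).const_mul
      ((s : ℝ) ^ (-(1 + θ))))
    fun x => by
      exact bregman_rpow_affine_le hθ hθ1 (show (1 : ℝ) ≤ s by linarith)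
        (childProd_pos (s := s) hX.pos x)
  rw [integral_const_mul] at h1
  rw [integral_sub (hiY.sub' c1) ((hY.integrable_id.sub' c1).const_mul (1 + θ)),
    integral_sub hiY c1, integral_const_mul, integral_sub hY.integrable_id c1,
    integral_sub (hiP.sub' c1) ((hX.integrable_childProd.sub' c1).const_mul (1 + θ)),
    integral_sub hiP c1, integral_const_mul, integral_sub hX.integrable_childProd c1,
    hP, hX.integral_rpow_childProd] at h1
  unfold mean at hm'
  rw [hm'] at h1
  simpa [rpowMoment] using h1

theorem mul_entropy_le (hX : IsIIDPos μ X) (hH : ∀ i x, 1 / 2 ≤ X i x) (hm : mean μ X = 1)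
    {θ : ℝ} (hθ : 0 ≤ θ) (hθ1 : θ ≤ 1) : θ * entropy μ X ≤ rpowMoment μ X θ - 1 := by
  rw [hX.entropy_eq hH hm, ← integral_const_mul]
  have h := integral_mono (hX.integrable_id.fun_add ((hX.integrable_mul_log hH).const_mul θ))
    (hX.integrable_rpow hθ hθ1) fun x => add_mul_log_le_rpow (θ := θ) (hX.pos 1 x)
  rw [integral_add hX.integrable_id ((hX.integrable_mul_log hH).const_mul θ)] at h
  unfold mean at hm
  rw [hm] at h
  unfold rpowMoment
  linarith

theorem exists_rpowMoment_le (hX : IsIIDPos μ X) (hH : ∀ i x, 1 / 2 ≤ X i x)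
    (hm : mean μ X = 1) : ∃ C : ℝ, 0 ≤ C ∧ ∀ θ : ℝ, 0 ≤ θ → θ ≤ 1 →
      rpowMoment μ X θ - 1 ≤ θ * entropy μ X + θ ^ 2 * C := by
  have hi : Integrable (fun x => X 1 x * (1 + X 1 x) ^ 2 * (2 + X 1 x)) μ :=
    hX.integrable_comp (f := fun y => y * (1 + y) ^ 2 * (2 + y)) (by fun_prop) 12 4 fun x => by
      have h0 := hX.pos 1 x
      have hp : 0 ≤ X 1 x * (1 + X 1 x) ^ 2 * (2 + X 1 x) := by positivity
      rw [abs_of_nonneg hp]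
      nlinarith [sq_nonneg (X 1 x - 1), sq_nonneg (X 1 x ^ 2 - 1), sq_nonneg (X 1 x ^ 2 - X 1 x)]
  refine ⟨∫ x, X 1 x * (1 + X 1 x) ^ 2 * (2 + X 1 x) ∂μ, integral_nonneg fun x => ?_, ?_⟩
  · have h0 := hX.pos 1 x
    simp only [Pi.zero_apply]
    positivity
  intro θ hθ hθ1
  rw [hX.entropy_eq hH hm, ← integral_const_mul, ← integral_const_mul]
  have h := integral_mono (hX.integrable_rpow hθ hθ1)
    ((hX.integrable_id.fun_add ((hX.integrable_mul_log hH).const_mul θ)).fun_add (hi.const_mul (θ ^ 2)))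
    fun x => rpow_le_add_mul_log hθ hθ1 (hH 1 x)
  rw [integral_add (hX.integrable_id.fun_add ((hX.integrable_mul_log hH).const_mul θ))
    (hi.const_mul (θ ^ 2)), integral_add hX.integrable_id
    ((hX.integrable_mul_log hH).const_mul θ)] at h
  unfold mean at hm
  rw [hm] at h
  unfold rpowMoment
  linarith

theorem neg_logMean_le (hX : IsIIDPos μ X) (hH : ∀ i x, 1 / 2 ≤ X i x) (hm : mean μ X = 1) :
    -logMean μ X ≤ 6 * entropy μ X := by
  have := hX.indep.isProbabilityMeasure
  have c1 : Integrable (fun _ : Ω => (1 : ℝ)) μ := integrable_const _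
  have h := integral_mono ((hX.integrable_id.sub' c1).sub' (hX.integrable_log hH))
    (hX.integrable_hellinger.const_mul 6) fun x => sub_one_sub_log_le (hH 1 x)
  rw [integral_sub (hX.integrable_id.sub' c1) (hX.integrable_log hH),
    integral_sub hX.integrable_id c1, integral_const_mul] at h
  unfold mean at hm
  rw [hm] at h
  have h2 := hX.hellinger_le_entropy hH
  unfold hellinger at h2
  unfold logMean
  simp at h
  linarith

end IsIIDPos

end

end HierarchicalPinning

/-! ### Decay at mean one, and comparison with a larger family. -/

namespace HierarchicalPinning

/-- Strict Bernoulli: `1` is the only positive fixed point of the mean recursion, and all other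
positive points move up. -/
theorem natCast_mul_lt_pow_add {s : ℕ} (hs : 2 ≤ s) {p : ℝ} (hp : 0 < p) (hp1 : p ≠ 1) :
    p < (p ^ s + ((s : ℝ) - 1)) / s := by
  have hs1 : (1 : ℝ) < s := by exact_mod_cast hs
  have h := one_add_mul_self_lt_rpow_one_add (s := p - 1) (by linarith) (sub_ne_zero.2 hp1) hs1
  rw [add_sub_cancel, Real.rpow_natCast] at h
  rw [lt_div_iff₀ (by linarith)]
  linarith

/-- If `e` stayed above `ε`, then `d n ≥ ε² / (9 w n)` would be at least a multiple of `1 / (n +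
1)`, whose sum diverges, whereas `c ∑ d n ≤ e 0`. -/
theorem exists_lt_of_entropy_dissipation {e d w : ℕ → ℝ} {c K : ℝ} (hc : 0 < c) (hK : 0 ≤ K)
    (he : ∀ n, 0 ≤ e n) (hed : ∀ n, e (n + 1) ≤ e n - c * d n)
    (hw : ∀ n, w n ≤ w 0 + K * n) (hcs : ∀ n, e n ^ 2 ≤ 9 * (d n * w n))
    (hw0 : ∀ n, 0 ≤ w n) {ε : ℝ} (hε : 0 < ε) : ∃ n, e n < ε := by
  by_contra! hcon
  set A := w 0 + K + 1 with hA
  have hA0 : 0 < A := by have := hw0 0; linarith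
  have hd : ∀ n : ℕ, ε ^ 2 / (9 * A) * (1 / ((n : ℝ) + 1)) ≤ d n := by
    intro n
    have h1 : ε ^ 2 ≤ 9 * (d n * w n) :=
      (pow_le_pow_left₀ hε.le (hcon n) 2).trans (hcs n)
    have hε2 : 0 < ε ^ 2 := by positivity
    have hdn : 0 < d n := by
      by_contra! hdn
      have := mul_nonpos_of_nonpos_of_nonneg hdn (hw0 n)
      linarith
    have hn : (0 : ℝ) ≤ n := Nat.cast_nonneg n
    have h2 : w n ≤ A * ((n : ℝ) + 1) := by
      have := hw n; have := hw0 0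
      rw [hA]; nlinarith
    have h3 := mul_le_mul_of_nonneg_left h2 hdn.le
    rw [div_mul_div_comm, div_le_iff₀ (by positivity)]
    nlinarith
  have hsum : ∀ N : ℕ, c * ∑ n ∈ Finset.range N, d n ≤ e 0 - e N := by
    intro N
    induction N with
    | zero => simp
    | succ N ih => rw [Finset.sum_range_succ]; have := hed N; linarith
  have hdiv := Real.tendsto_sum_range_one_div_nat_succ_atTop
  set B := c * (ε ^ 2 / (9 * A)) with hB
  have hB0 : 0 < B := by positivity
  obtain ⟨N, hN⟩ := (hdiv.eventually_gt_atTop (e 0 / B)).exists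
  rw [div_lt_iff₀ hB0] at hN
  have h4 := Finset.sum_le_sum (s := Finset.range N) fun n _ => hd n
  rw [← Finset.mul_sum] at h4
  have h5 := mul_le_mul_of_nonneg_left h4 hc.le
  have h6 := hsum N
  have h7 := he N
  rw [← mul_assoc, ← hB] at h5
  linarith

variable {Ω : Type*} {s : ℕ} {X X' : ℕ → Ω → ℝ}

theorem half_le_iterate_step (hs : 2 ≤ s) (hH : ∀ i x, 1 / 2 ≤ X i x) (n i : ℕ) (x : Ω) :
    1 / 2 ≤ (step s)^[n] X i x := by
  induction n generalizing i x with
  | zero => exact hH i x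
  | succ n ih =>
    rw [Function.iterate_succ_apply']
    exact half_le_step hs (fun i x => by linarith [ih i x]) i x

/-- The deterministic lower bound for the partition functions. -/
noncomputable def lowerBound (s : ℕ) : ℕ → ℝ
  | 0 => 1 / 2
  | n + 1 => (lowerBound s n ^ s + ((s : ℝ) - 1)) / s

theorem lowerBound_mem {s : ℕ} (hs : 2 ≤ s) (n : ℕ) : lowerBound s n ∈ Set.Icc (1 / 2 : ℝ) 1 := by
  have hs2 : (2 : ℝ) ≤ s := by exact_mod_cast hs
  induction n with
  | zero => constructor <;> norm_num [lowerBound]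
  | succ n ih =>
    have h0 : (0 : ℝ) ≤ lowerBound s n := by linarith [ih.1]
    have h1 := pow_le_one₀ (n := s) h0 ih.2
    have h2 := pow_nonneg h0 s
    constructor
    · rw [lowerBound, le_div_iff₀ (by linarith)]; linarith
    · rw [lowerBound, div_le_one (by linarith)]; linarith

theorem tendsto_lowerBound {s : ℕ} (hs : 2 ≤ s) : Tendsto (lowerBound s) atTop (𝓝 1) := by
  have hmono : Monotone (lowerBound s) := by
    refine monotone_nat_of_le_succ fun n => ?_
    have h := lowerBound_mem hs n
    rcases eq_or_ne (lowerBound s n) 1 with h1 | h1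
    · rw [lowerBound, h1]; field_simp; simp
    · rw [lowerBound]; exact (natCast_mul_lt_pow_add hs (by linarith [h.1]) h1).le
  have hbdd : BddAbove (Set.range (lowerBound s)) := ⟨1, by
    rintro _ ⟨n, rfl⟩; exact (lowerBound_mem hs n).2⟩
  have hlim := tendsto_atTop_ciSup hmono hbdd
  set l := ⨆ n, lowerBound s n
  have hl : 1 / 2 ≤ l := ge_of_tendsto' hlim fun n => (lowerBound_mem hs n).1
  have h1 : Tendsto (fun n => lowerBound s (n + 1)) atTop (𝓝 ((l ^ s + ((s : ℝ) - 1)) / s)) :=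
    ((hlim.pow s).add_const _).div_const _
  have h2 := tendsto_nhds_unique h1 ((tendsto_add_atTop_iff_nat 1).2 hlim)
  have h3 : l = 1 := by
    by_contra hne
    exact (natCast_mul_lt_pow_add hs (by linarith) hne).ne' h2
  rwa [h3] at hlim

theorem lowerBound_le_iterate_step (hH : ∀ i x, 1 / 2 ≤ X i x) (hs : 2 ≤ s)
    (n i : ℕ) (x : Ω) : lowerBound s n ≤ (step s)^[n] X i x := by
  induction n generalizing i with
  | zero => exact hH i x
  | succ n ih =>
    rw [Function.iterate_succ_apply', lowerBound, step]
    have h0 : (0 : ℝ) ≤ lowerBound s n := by linarith [(lowerBound_mem hs n).1]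
    have := Finset.prod_le_prod (s := Finset.Icc 1 s) (f := fun _ => lowerBound s n)
      (fun j _ => h0) fun j _ => ih (s * i + j)
    rw [Finset.prod_const, Nat.card_Icc, Nat.add_sub_cancel] at this
    gcongr

theorem iterate_step_mono (hH : ∀ i x, 1 / 2 ≤ X i x) (hle : ∀ i x, X i x ≤ X' i x) (hs : 2 ≤ s)
    (n i : ℕ) (x : Ω) : (step s)^[n] X i x ≤ (step s)^[n] X' i x := by
  induction n generalizing i with
  | zero => exact hle i x
  | succ n ih =>
    rw [Function.iterate_succ_apply', Function.iterate_succ_apply', step, step]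
    have := Finset.prod_le_prod (s := Finset.Icc 1 s)
      (fun j _ => by linarith [half_le_iterate_step hs hH n (s * i + j) x]) fun j _ => ih (s * i + j)
    gcongr

variable [MeasurableSpace Ω] {μ : Measure Ω}

namespace IsIIDPos

theorem mean_iterate_step_eq_one (hX : IsIIDPos μ X) (hs : 2 ≤ s) (hm : mean μ X = 1) (n : ℕ) :
    mean μ ((HierarchicalPinning.step s)^[n] X) = 1 := by
  have hs0 : (s : ℝ) ≠ 0 := by positivity
  induction n with
  | zero => exact hm
  | succ n ih =>
    rw [Function.iterate_succ_apply', (hX.iterate_step hs n).mean_step, ih, one_pow,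
      add_sub_cancel, div_self hs0]

theorem mean_iterate_step_le_one (hX : IsIIDPos μ X) (hs : 2 ≤ s) (hm : mean μ X ≤ 1) (n : ℕ) :
    mean μ ((HierarchicalPinning.step s)^[n] X) ≤ 1 := by
  have hs0 : (0 : ℝ) < s := by positivity
  induction n with
  | zero => exact hm
  | succ n ih =>
    have hY := hX.iterate_step hs n
    rw [Function.iterate_succ_apply', hY.mean_step, div_le_one hs0]
    have := pow_le_one₀ (n := s) (integral_nonneg fun x => (hY.pos 1 x).le) ih
    unfold mean at *
    linarith

theorem logMean_le_mean_sub_one (hX : IsIIDPos μ X) (hH : ∀ i x, 1 / 2 ≤ X i x) :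
    logMean μ X ≤ mean μ X - 1 := by
  have := hX.indep.isProbabilityMeasure
  have c1 : Integrable (fun _ : Ω => (1 : ℝ)) μ := integrable_const _
  have h := integral_mono (hX.integrable_log hH) (hX.integrable_id.sub' c1)
    fun x => Real.log_le_sub_one_of_pos (hX.pos 1 x)
  rw [integral_sub hX.integrable_id c1] at h
  simpa [logMean, mean] using h

/-- The relative entropy tends to zero along the recursion started from mean one. -/
theorem exists_entropy_lt (hX : IsIIDPos μ X) (hH : ∀ i x, 1 / 2 ≤ X i x) (hs : 2 ≤ s)
    (hm : mean μ X = 1) {ε : ℝ} (hε : 0 < ε) :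
    ∃ n, entropy μ ((HierarchicalPinning.step s)^[n] X) < ε := by
  have hY := hX.iterate_step hs
  have hYH := half_le_iterate_step hs hH
  have hYm := hX.mean_iterate_step_eq_one hs hm
  have hs0 : (0 : ℝ) < s := by positivity
  have hed : ∀ n, entropy μ ((HierarchicalPinning.step s)^[n + 1] X)
      ≤ entropy μ ((HierarchicalPinning.step s)^[n] X)
        - 1 / (2 * s) * hellinger μ ((HierarchicalPinning.step s)^[n] X) := by
    intro n
    rw [Function.iterate_succ_apply', one_div_mul_eq_div]
    exact (hY n).entropy_step_le (hYH n) hs (hYm n)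
  have hle : ∀ n, entropy μ ((HierarchicalPinning.step s)^[n] X) ≤ entropy μ X := by
    intro n
    induction n with
    | zero => exact le_rfl
    | succ n ih =>
      have h0 : 0 ≤ hellinger μ ((HierarchicalPinning.step s)^[n] X) :=
        integral_nonneg fun x => sq_nonneg _
      have h1 : 0 ≤ 1 / (2 * (s : ℝ)) * hellinger μ ((HierarchicalPinning.step s)^[n] X) := by
        positivity
      have := hed n
      linarith
  refine exists_lt_of_entropy_dissipation (c := 1 / (2 * s)) (K := s * entropy μ X ^ 2 + 5)
    (e := fun n => entropy μ ((HierarchicalPinning.step s)^[n] X))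
    (d := fun n => hellinger μ ((HierarchicalPinning.step s)^[n] X))
    (w := fun n => sqLogMoment μ ((HierarchicalPinning.step s)^[n] X))
    (by positivity) (by positivity) (fun n => (hY n).entropy_nonneg (hYH n)) hed ?_
    (fun n => (hY n).sq_entropy_le (hYH n)) (fun n => (hY n).sqLogMoment_nonneg) hε
  intro n
  induction n with
  | zero => simp
  | succ n ih =>
    have h1 := (hY n).sqLogMoment_step_le (hYH n) hs (hYm n)
    have h2 := pow_le_pow_left₀ ((hY n).entropy_nonneg (hYH n)) (hle n) 2
    have h3 := mul_le_mul_of_nonneg_left h2 hs0.le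
    simp only [Function.iterate_succ_apply'] at ih ⊢
    push_cast
    linarith

/-- With `u` the excess of the moment over `1`, `(1 + u) ^ s - 1 ≤ s u exp (s u)`. The linear rate
is `s ^ (-θ)`; the smallness condition on `u` costs at most `s ^ (θ / 2)`, leaving the contraction
factor `s ^ (-θ / 2)`. -/
theorem rpowMoment_step_le_exp_mul (hX : IsIIDPos μ X) (hs : 2 ≤ s) (hm : mean μ X = 1) {θ : ℝ}
    (hθ : 0 ≤ θ) (hθ1 : θ ≤ 1) (h0 : 0 ≤ rpowMoment μ X θ - 1)
    (hu : s * (rpowMoment μ X θ - 1) ≤ θ / 2 * Real.log s) :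
    rpowMoment μ (HierarchicalPinning.step s X) θ - 1
      ≤ Real.exp (-(θ / 2 * Real.log s)) * (rpowMoment μ X θ - 1) := by
  have hs0 : (0 : ℝ) < s := by positivity
  refine (hX.rpowMoment_step_le hs hm hθ hθ1).trans ?_
  set u := rpowMoment μ X θ - 1 with hu_def
  have hM : rpowMoment μ X θ = u + 1 := by rw [hu_def]; ring
  have h1 : (u + 1) ^ s - 1 ≤ s * u * Real.exp (s * u) := by
    have h2 : (u + 1) ^ s ≤ Real.exp (s * u) := by
      rw [Real.exp_nat_mul]
      exact pow_le_pow_left₀ (by linarith) (Real.add_one_le_exp u) s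
    have h3 := Real.add_one_le_exp (-(s * u))
    rw [Real.exp_neg] at h3
    have h4 := mul_le_mul_of_nonneg_right h3 (Real.exp_pos (s * u)).le
    rw [inv_mul_cancel₀ (Real.exp_pos _).ne'] at h4
    linarith
  have h5 : Real.exp (s * u) ≤ Real.exp (θ / 2 * Real.log s) := Real.exp_le_exp.2 hu
  rw [hM]
  calc (s : ℝ) ^ (-(1 + θ)) * ((u + 1) ^ s - 1)
      ≤ (s : ℝ) ^ (-(1 + θ)) * (s * u * Real.exp (θ / 2 * Real.log s)) := by
        gcongr
        exact h1.trans (by gcongr)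
    _ = _ := by
        have h6 : (s : ℝ) ^ (-(1 + θ)) * s = Real.exp (-(θ * Real.log s)) := by
          nth_rewrite 2 [← Real.rpow_one (s : ℝ)]
          rw [← Real.rpow_add hs0, Real.rpow_def_of_pos hs0]
          congr 1; ring
        have h7 : Real.exp (-(θ / 2 * Real.log s))
            = Real.exp (-(θ * Real.log s)) * Real.exp (θ / 2 * Real.log s) := by
          rw [← Real.exp_add]; congr 1; ring
        rw [h7, ← h6]; ring

/-- Started from mean one, the mean logarithm decays exponentially fast. -/
theorem exists_neg_logMean_le_geometric (hX : IsIIDPos μ X) (hH : ∀ i x, 1 / 2 ≤ X i x)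
    (hs : 2 ≤ s) (hm : mean μ X = 1) :
    ∃ q C : ℝ, ∃ N : ℕ, 0 < q ∧ q < 1 ∧
      ∀ k, -logMean μ ((HierarchicalPinning.step s)^[k + N] X) ≤ C * q ^ k := by
  have hY := hX.iterate_step hs
  have hYH := half_le_iterate_step hs hH
  have hYm := hX.mean_iterate_step_eq_one hs hm
  have hs0 : (0 : ℝ) < s := by positivity
  have hs1 : (1 : ℝ) < s := by exact_mod_cast hs
  have hlog : 0 < Real.log s := Real.log_pos hs1
  -- Chosen so that `s * (2 * θ * κ) = θ / 2 * log s`, the threshold of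
  -- `rpowMoment_step_le_exp_mul`. An entropy below `κ` together with `θ * C ≤ κ` puts the starting
  -- excess under `2 * θ * κ`.
  set κ := Real.log s / (4 * s) with hκ
  have hκ0 : 0 < κ := by positivity
  obtain ⟨N, hN⟩ := hX.exists_entropy_lt hH hs hm hκ0
  obtain ⟨C, hC, hCb⟩ := (hY N).exists_rpowMoment_le (hYH N) (hYm N)
  set θ := min 1 (κ / (C + 1)) with hθ
  have hθ0 : 0 < θ := lt_min one_pos (by positivity)
  have hθ1 : θ ≤ 1 := min_le_left _ _
  have hθC : θ * C ≤ κ := by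
    have h1 : θ ≤ κ / (C + 1) := min_le_right _ _
    rw [le_div_iff₀ (by linarith)] at h1
    linarith
  set q := Real.exp (-(θ / 2 * Real.log s)) with hq
  have hq0 : 0 < q := Real.exp_pos _
  have hq1 : q < 1 := by
    rw [hq, Real.exp_lt_one_iff]
    have : 0 < θ / 2 * Real.log s := by positivity
    linarith
  have hnn : ∀ n, 0 ≤ rpowMoment μ ((HierarchicalPinning.step s)^[n] X) θ - 1 := fun n =>
    (mul_nonneg hθ0.le ((hY n).entropy_nonneg (hYH n))).trans
      ((hY n).mul_entropy_le (hYH n) (hYm n) hθ0.le hθ1)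
  have hu : ∀ k, rpowMoment μ ((HierarchicalPinning.step s)^[k + N] X) θ - 1
      ≤ q ^ k * (2 * θ * κ) := by
    intro k
    induction k with
    | zero =>
      rw [zero_add, pow_zero, one_mul]
      refine (hCb θ hθ0.le hθ1).trans ?_
      have h1 := mul_le_mul_of_nonneg_left hN.le hθ0.le
      have h2 := mul_le_mul_of_nonneg_left hθC hθ0.le
      nlinarith
    | succ k ih =>
      rw [Nat.add_right_comm, Function.iterate_succ_apply']
      have hqk : q ^ k ≤ 1 := pow_le_one₀ hq0.le hq1.le
      have h1 : rpowMoment μ ((HierarchicalPinning.step s)^[k + N] X) θ - 1 ≤ 2 * θ * κ :=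
        ih.trans (mul_le_of_le_one_left (by positivity) hqk)
      have h2 : s * (rpowMoment μ ((HierarchicalPinning.step s)^[k + N] X) θ - 1)
          ≤ θ / 2 * Real.log s := by
        refine (mul_le_mul_of_nonneg_left h1 hs0.le).trans (le_of_eq ?_)
        rw [hκ]; field_simp; ring
      refine ((hY (k + N)).rpowMoment_step_le_exp_mul hs (hYm _) hθ0.le hθ1 (hnn _) h2).trans ?_
      rw [← hq, pow_succ', mul_assoc]
      exact mul_le_mul_of_nonneg_left ih hq0.le
  refine ⟨q, 12 * κ, N, hq0, hq1, fun k => ?_⟩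
  have h1 := (hY (k + N)).neg_logMean_le (hYH _) (hYm _)
  have h2 := ((hY (k + N)).mul_entropy_le (hYH _) (hYm _) hθ0.le hθ1).trans (hu k)
  have h3 : entropy μ ((HierarchicalPinning.step s)^[k + N] X) ≤ q ^ k * (2 * κ) := by
    refine le_of_mul_le_mul_left (h2.trans (le_of_eq ?_)) hθ0
    ring
  linarith

/-- Once the mean logarithm is positive, it grows at least linearly. -/
theorem exists_linear_growth (hX : IsIIDPos μ X) (hH : ∀ i x, 1 / 2 ≤ X i x) (hs : 2 ≤ s)
    (hL : 0 < logMean μ X) :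
    ∃ η : ℝ, 0 < η ∧ ∀ k : ℕ, k * η ≤ logMean μ ((HierarchicalPinning.step s)^[k] X) := by
  have := hX.indep.isProbabilityMeasure
  have hY := hX.iterate_step hs
  have hYH := half_le_iterate_step hs hH
  have hs0 : (0 : ℝ) < s := by positivity
  have hs1 : (1 : ℝ) < s := by exact_mod_cast hs
  set L := logMean μ X with hLdef
  set p := Real.exp L with hp
  have hp0 : 0 < p := Real.exp_pos _
  have hp1 : 1 < p := Real.one_lt_exp_iff.2 hL
  -- Slope of the tangent at `t = s * L`, the mean of the logarithm of the product at the start. As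
  -- `p > 1`, the effective slope `l * s` is at least `1`, so the excess over `L` is not contracted
  -- and each step adds `η`.
  set l := p ^ s / (p ^ s + ((s : ℝ) - 1)) with hl
  have hps : 1 ≤ p ^ s := one_le_pow₀ hp1.le
  have hls : 1 ≤ l * s := by
    rw [hl, div_mul_eq_mul_div, le_div_iff₀ (by linarith)]
    nlinarith
  set η := Real.log ((p ^ s + ((s : ℝ) - 1)) / s) - L with hη
  have hη0 : 0 < η := by
    have h := Real.log_lt_log hp0 (natCast_mul_lt_pow_add hs hp0 hp1.ne')
    rw [hp, Real.log_exp] at h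
    rw [hη]; linarith
  have hstep : ∀ n, L + η + l * s * (logMean μ ((HierarchicalPinning.step s)^[n] X) - L)
      ≤ logMean μ ((HierarchicalPinning.step s)^[n + 1] X) := by
    intro n
    rw [Function.iterate_succ_apply']
    set Y := (HierarchicalPinning.step s)^[n] X with hYdef
    have hlogP := (hY n).integrable_log_childProd (s := s) (hYH n)
    have c1 : ∀ c : ℝ, Integrable (fun _ : Ω => c) μ := fun c => integrable_const _
    have h := integral_mono ((c1 (L + η)).fun_add ((hlogP.sub' (c1 (s * L))).const_mul l))
      (((hY n).step hs).integrable_log (half_le_step hs (hY n).pos)) fun x => by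
        have h1 := log_affine_tangent hs1.le (childProd_pos (s := s) (hY n).pos x)
          (pow_pos hp0 s)
        rw [Real.log_pow, hp, Real.log_exp] at h1
        show L + η + l * (Real.log (childProd s Y x) - s * L) ≤ Real.log
          (HierarchicalPinning.step s Y 1 x)
        rw [hη, add_sub_cancel]
        exact h1
    rw [integral_add (c1 _) ((hlogP.sub' (c1 _)).const_mul l), integral_const_mul,
      integral_sub hlogP (c1 _), (hY n).integral_log_childProd (hYH n)] at h
    simp only [integral_const, probReal_univ, smul_eq_mul, one_mul] at h
    unfold logMean at h ⊢
    linarith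
  have hgrow : ∀ k : ℕ, L + k * η ≤ logMean μ ((HierarchicalPinning.step s)^[k] X) := by
    intro k
    induction k with
    | zero => simp [hLdef]
    | succ k ih =>
      have h1 := hstep k
      have hk : 0 ≤ (k : ℝ) * η := by positivity
      have h2 : 0 ≤ logMean μ ((HierarchicalPinning.step s)^[k] X) - L := by linarith
      have h3 := mul_le_mul_of_nonneg_right hls h2
      push_cast
      linarith
  exact ⟨η, hη0, fun k => by have := hgrow k; linarith⟩

/-- The difference of mean logarithms of two ordered families contracts at most by the slope of
the recursion at a common lower bound. -/
theorem logMean_step_sub_ge (hX : IsIIDPos μ X) (hX' : IsIIDPos μ X')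
    (hH : ∀ i x, 1 / 2 ≤ X i x) (hle : ∀ i x, X i x ≤ X' i x) (hs : 2 ≤ s) {r : ℝ}
    (hr : 0 < r) (hrX : ∀ i x, r ≤ X i x) :
    s * r ^ s / (r ^ s + ((s : ℝ) - 1)) * (logMean μ X' - logMean μ X)
      ≤ logMean μ (HierarchicalPinning.step s X') - logMean μ (HierarchicalPinning.step s X) := by
  have hs1 : (1 : ℝ) < s := by exact_mod_cast hs
  have hH' : ∀ i x, 1 / 2 ≤ X' i x := fun i x => (hH i x).trans (hle i x)
  set l := r ^ s / (r ^ s + ((s : ℝ) - 1)) with hl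
  have i1 := hX.integrable_log_childProd (s := s) hH
  have i2 := hX'.integrable_log_childProd (s := s) hH'
  have i3 := (hX.step hs).integrable_log (half_le_step hs hX.pos)
  have i4 := (hX'.step hs).integrable_log (half_le_step hs hX'.pos)
  have h := integral_mono ((i2.sub' i1).const_mul l) (i4.sub' i3) fun x => by
    have hP := childProd_pos (s := s) hX.pos x
    have hPP' : childProd s X x ≤ childProd s X' x :=
      Finset.prod_le_prod (fun j _ => (hX.pos _ x).le) fun j _ => hle _ x
    have hrP : r ^ s ≤ childProd s X x := by
      have := Finset.prod_le_prod (s := Finset.Icc 1 s) (f := fun _ => r)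
        (fun j _ => hr.le) fun j _ => hrX (s * 1 + j) x
      simpa [childProd] using this
    have ht := log_affine_tangent hs1.le (childProd_pos (s := s) hX'.pos x) hP
    have hlog : 0 ≤ Real.log (childProd s X' x) - Real.log (childProd s X x) :=
      sub_nonneg.2 (Real.log_le_log hP hPP')
    -- The slope `P / (P + s - 1)` is increasing in `P`, so its value at the lower bound `r ^ s`
    -- serves everywhere.
    have hll : l ≤ childProd s X x / (childProd s X x + ((s : ℝ) - 1)) := by
      have := pow_pos hr s
      rw [hl, div_le_div_iff₀ (by linarith) (by linarith)]
      nlinarith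
    have h1 := mul_le_mul_of_nonneg_right hll hlog
    show l * (Real.log (childProd s X' x) - Real.log (childProd s X x))
      ≤ Real.log ((childProd s X' x + ((s : ℝ) - 1)) / s)
        - Real.log ((childProd s X x + ((s : ℝ) - 1)) / s)
    linarith
  rw [integral_const_mul, integral_sub i2 i1, integral_sub i4 i3,
    hX.integral_log_childProd hH, hX'.integral_log_childProd hH'] at h
  refine le_trans (le_of_eq ?_) h
  rw [hl]; ring

end IsIIDPos

/-- A sequence whose successive ratios are bounded below by numbers tending to one cannot decay
geometrically. -/
theorem not_geometric_decay {D g : ℕ → ℝ} {C q : ℝ} {N : ℕ} (hD : 0 < D 0)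
    (hg0 : ∀ n, 0 < g n) (hg : Tendsto g atTop (𝓝 1)) (hDg : ∀ n, g n * D n ≤ D (n + 1))
    (hq0 : 0 < q) (hq1 : q < 1) : ¬ ∀ k, D (k + N) ≤ C * q ^ k := by
  intro hcon
  have hpos : ∀ n, 0 < D n := fun n => by
    induction n with
    | zero => exact hD
    | succ n ih => exact (mul_pos (hg0 n) ih).trans_le (hDg n)
  -- Any rate strictly between `q` and `1`: eventually `D` decays no faster than `r ^ k`, so its
  -- value at a fixed index would be at most a constant times `(q / r) ^ k`.
  set r := (1 + q) / 2 with hr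
  have hr0 : 0 < r := by linarith
  have hqr : q < r := by linarith
  obtain ⟨M, hM⟩ := eventually_atTop.1 (hg.eventually_const_le (show r < 1 by linarith))
  have h1 : ∀ k, r ^ k * D (M + N) ≤ D (k + (M + N)) := by
    intro k
    induction k with
    | zero => simp
    | succ k ih =>
      have h2 := hM (k + (M + N)) (by omega)
      have h3 := hDg (k + (M + N))
      have h4 := mul_le_mul_of_nonneg_right h2 (hpos (k + (M + N))).le
      have h5 := mul_le_mul_of_nonneg_left ih hr0.le
      rw [Nat.add_right_comm, pow_succ']
      linarith
  have h2 : ∀ k, D (M + N) ≤ C * q ^ M * (q / r) ^ k := by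
    intro k
    have h3 := (h1 k).trans (le_of_eq_of_le (by rw [add_assoc]) (hcon (k + M)))
    have hrk := pow_pos hr0 k
    rw [div_pow, mul_div_assoc', le_div_iff₀ hrk]
    calc D (M + N) * r ^ k = r ^ k * D (M + N) := mul_comm _ _
      _ ≤ C * q ^ (k + M) := h3
      _ = _ := by rw [pow_add]; ring
  have h3 : Tendsto (fun k : ℕ => C * q ^ M * (q / r) ^ k) atTop (𝓝 (C * q ^ M * 0)) :=
    (tendsto_pow_atTop_nhds_zero_of_lt_one (by positivity)
      ((div_lt_one hr0).2 hqr)).const_mul _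
  have h4 := ge_of_tendsto' h3 h2
  rw [mul_zero] at h4
  exact absurd h4 (not_le.2 (hpos _))

/-- A family dominating one with mean one, with strictly larger mean logarithm, eventually gets a
positive mean logarithm. -/
theorem exists_logMean_pos (hX : IsIIDPos μ X) (hX' : IsIIDPos μ X')
    (hH : ∀ i x, 1 / 2 ≤ X i x) (hle : ∀ i x, X i x ≤ X' i x) (hs : 2 ≤ s)
    (hm : mean μ X = 1) (hlt : logMean μ X < logMean μ X') :
    ∃ n, 0 < logMean μ ((step s)^[n] X') := by
  by_contra! hcon
  have hs1 : (1 : ℝ) < s := by exact_mod_cast hs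
  obtain ⟨q, C, N, hq0, hq1, hC⟩ := hX.exists_neg_logMean_le_geometric hH hs hm
  have hlb : ∀ n, 0 < lowerBound s n := fun n => by linarith [(lowerBound_mem hs n).1]
  -- If the mean logarithm of `X'` is never positive, the gap is at most `-logMean` for `X`, which
  -- decays geometrically, while the slopes `g` at `lowerBound` tend to `1`.
  refine not_geometric_decay
    (D := fun n => logMean μ ((step s)^[n] X') - logMean μ ((step s)^[n] X))
    (g := fun n => s * lowerBound s n ^ s / (lowerBound s n ^ s + ((s : ℝ) - 1)))
    (sub_pos.2 hlt) (fun n => ?_) ?_ (fun n => ?_) hq0 hq1 (N := N) (C := C) fun k => ?_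
  · have := pow_pos (hlb n) s
    exact div_pos (by positivity) (by linarith)
  · have h1 := (tendsto_lowerBound hs).pow s
    have h2 := (h1.const_mul (s : ℝ)).div (h1.add_const ((s : ℝ) - 1)) (by simp; linarith)
    have h3 : (s : ℝ) * 1 ^ s / (1 ^ s + ((s : ℝ) - 1)) = 1 := by
      rw [one_pow, add_sub_cancel, mul_one, div_self (by linarith)]
    rw [h3] at h2
    exact h2
  · simp only [Function.iterate_succ_apply']
    exact (hX.iterate_step hs n).logMean_step_sub_ge (hX'.iterate_step hs n)
      (half_le_iterate_step hs hH n) (iterate_step_mono hH hle hs n) hs (hlb n)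
      (lowerBound_le_iterate_step hH hs n)
  · have h1 := hC k
    have h2 := hcon (k + N)
    linarith

end HierarchicalPinning

/-! ### Existence of the free energy by the law of large numbers. -/

namespace HierarchicalPinning

section Sums

variable {Ω : Type*} {s : ℕ} {X : ℕ → Ω → ℝ}

/-- The sum over the children of each vertex. -/
def childSum (s : ℕ) (y : ℕ → ℝ) (i : ℕ) : ℝ := ∑ j ∈ Finset.Icc 1 s, y (s * i + j)

/-- The first descendant of the vertex `1` after `k` generations. -/
def firstDescendant (s : ℕ) : ℕ → ℕ
  | 0 => 1
  | k + 1 => s * firstDescendant s k + 1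

theorem one_le_firstDescendant (s k : ℕ) : 1 ≤ firstDescendant s k := by
  cases k <;> simp [firstDescendant]

theorem firstDescendant_lt {s : ℕ} (hs : 2 ≤ s) (k : ℕ) : firstDescendant s k < 2 * s ^ k := by
  induction k with
  | zero => simp [firstDescendant]
  | succ k ih =>
    rw [firstDescendant, pow_succ]
    have := Nat.mul_le_mul_left s (Nat.succ_le_of_lt ih)
    rw [Nat.mul_succ] at this
    nlinarith

theorem pow_le_firstDescendant (s k : ℕ) : s ^ k ≤ firstDescendant s k := by
  induction k with
  | zero => simp [firstDescendant]
  | succ k ih =>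
    rw [firstDescendant, pow_succ']
    have := Nat.mul_le_mul_left s ih
    omega

theorem sum_Ico_childSum (s : ℕ) (y : ℕ → ℝ) (a n : ℕ) :
    ∑ i ∈ Finset.Ico a (a + n), childSum s y i
      = ∑ m ∈ Finset.Ico (s * a + 1) (s * a + 1 + s * n), y m := by
  induction n with
  | zero => simp
  | succ n ih =>
    rw [← add_assoc, Finset.sum_Ico_succ_top (by omega), ih, Nat.mul_succ, ← add_assoc,
      ← Finset.sum_Ico_consecutive y (show s * a + 1 ≤ s * a + 1 + s * n by omega)
        (show s * a + 1 + s * n ≤ s * a + 1 + s * n + s by omega), childSum]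
    congr 1
    rw [Finset.sum_Ico_eq_sum_range, Nat.add_sub_cancel_left, ← Finset.Ico_add_one_right_eq_Icc,
      Finset.sum_Ico_eq_sum_range, Nat.add_sub_cancel]
    refine Finset.sum_congr rfl fun j _ => ?_
    congr 1; ring

/-- The descendants of a vertex in a given generation form an interval of indices, which links the
tree to the law of large numbers for sequences. -/
theorem iterate_childSum (s : ℕ) (y : ℕ → ℝ) (k : ℕ) :
    (childSum s)^[k] y 1
      = ∑ m ∈ Finset.Ico (firstDescendant s k) (firstDescendant s k + s ^ k), y m := by
  induction k generalizing y with
  | zero => simp [firstDescendant]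
  | succ k ih =>
    rw [Function.iterate_succ_apply, ih, sum_Ico_childSum, pow_succ', firstDescendant]

/-- The product `P` satisfies `P ≥ 2 ^ (-s)`, so the step lies between `P / s` and `2 ^ s * P`. -/
theorem abs_log_step_sub_le (hs : 2 ≤ s) (hH : ∀ i x, 1 / 2 ≤ X i x) (i : ℕ) (x : Ω) :
    |Real.log (step s X i x) - childSum s (fun j => Real.log (X j x)) i| ≤ s := by
  have hpos : ∀ i x, 0 < X i x := fun i x => by linarith [hH i x]
  have hs2 : (2 : ℝ) ≤ s := by exact_mod_cast hs
  have hs0 : (0 : ℝ) < s := by linarith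
  rw [childSum, ← Real.log_prod fun j _ => (hpos _ x).ne', step]
  set P := ∏ j ∈ Finset.Icc 1 s, X (s * i + j) x with hP
  have hP0 : 0 < P := Finset.prod_pos fun j _ => hpos _ x
  have hP2 : (1 / 2 : ℝ) ^ s ≤ P := by
    have := Finset.prod_le_prod (s := Finset.Icc 1 s) (f := fun _ => (1 / 2 : ℝ))
      (fun j _ => by norm_num) fun j _ => hH (s * i + j) x
    simpa using this
  rw [abs_le]
  constructor
  · have h1 : Real.log (P / s) ≤ Real.log ((P + ((s : ℝ) - 1)) / s) :=
      Real.log_le_log (by positivity) (by gcongr; linarith)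
    rw [Real.log_div hP0.ne' hs0.ne'] at h1
    have h2 := Real.log_le_sub_one_of_pos hs0
    linarith
  · have h1 : (P + ((s : ℝ) - 1)) / s ≤ 2 ^ s * P := by
      have h2 : 1 ≤ 2 ^ s * P := by
        have := mul_le_mul_of_nonneg_left hP2 (show (0 : ℝ) ≤ 2 ^ s by positivity)
        rw [← mul_pow] at this
        norm_num at this
        exact this
      have h3 : P ≤ 2 ^ s * P := le_mul_of_one_le_left hP0.le (one_le_pow₀ (by norm_num))
      rw [div_le_iff₀ hs0]
      nlinarith
    have h2 := Real.log_le_log (div_pos (by linarith) hs0) h1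
    rw [Real.log_mul (by positivity) hP0.ne', Real.log_pow] at h2
    have h3 := Real.log_le_sub_one_of_pos (show (0 : ℝ) < 2 by norm_num)
    nlinarith

theorem abs_log_iterate_step_sub_le (hs : 2 ≤ s) (hH : ∀ i x, 1 / 2 ≤ X i x) (x : Ω) (k : ℕ)
    (i : ℕ) : |Real.log ((step s)^[k] X i x) - (childSum s)^[k] (fun j => Real.log (X j x)) i|
      ≤ s * ((s : ℝ) ^ k - 1) := by
  have hs2 : (2 : ℝ) ≤ s := by exact_mod_cast hs
  induction k generalizing i with
  | zero => simp
  | succ k ih =>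
    rw [Function.iterate_succ_apply', Function.iterate_succ_apply']
    have h1 := abs_log_step_sub_le hs (half_le_iterate_step hs hH k) i x
    set y := (childSum s)^[k] (fun j => Real.log (X j x)) with hy
    have h2 : |childSum s (fun j => Real.log ((step s)^[k] X j x)) i - childSum s y i|
        ≤ s * (s * ((s : ℝ) ^ k - 1)) := by
      rw [childSum, childSum, ← Finset.sum_sub_distrib]
      refine (Finset.abs_sum_le_sum_abs _ _).trans ?_
      refine (Finset.sum_le_sum fun j _ => ih (s * i + j)).trans (le_of_eq ?_)
      simp
    refine (abs_sub_le _ (childSum s (fun j => Real.log ((step s)^[k] X j x)) i) _).trans ?_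
    rw [pow_succ]
    nlinarith [pow_pos (show (0 : ℝ) < s by linarith) k]

end Sums

variable {Ω : Type*} [MeasurableSpace Ω] {μ : Measure Ω} {s : ℕ} {X : ℕ → Ω → ℝ}

/-- The average of the logarithms over the descendants of the vertex `1` after `k` generations. -/
noncomputable def blockAverage (s : ℕ) (X : ℕ → Ω → ℝ) (k : ℕ) (x : Ω) : ℝ :=
  (childSum s)^[k] (fun j => Real.log (X j x)) 1 / (s : ℝ) ^ k

/-- The deviation of the empirical mean of the logarithms. -/
noncomputable def empiricalDev (μ : Measure Ω) (X : ℕ → Ω → ℝ) (n : ℕ) (x : Ω) : ℝ :=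
  (n : ℝ)⁻¹ • (∑ i ∈ Finset.range n, Real.log (X i x)) - logMean μ X

/-- The block moves with `k`, so its average is expressed through two averages of initial segments,
whose weights are bounded by `3` and `2`. -/
theorem blockAverage_sub_logMean (hs : 2 ≤ s) (k : ℕ) (x : Ω) :
    blockAverage s X k x - logMean μ X
      = ((firstDescendant s k + s ^ k : ℕ) / (s : ℝ) ^ k)
          * empiricalDev μ X (firstDescendant s k + s ^ k) x
        - (firstDescendant s k / (s : ℝ) ^ k) * empiricalDev μ X (firstDescendant s k) x := by
  have hs0 : (s : ℝ) ≠ 0 := by positivity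
  have ha : (firstDescendant s k : ℝ) ≠ 0 := by
    have := one_le_firstDescendant s k
    positivity
  have hb : ((firstDescendant s k + s ^ k : ℕ) : ℝ) ≠ 0 := by
    have := one_le_firstDescendant s k
    positivity
  rw [blockAverage, iterate_childSum, Finset.sum_Ico_eq_sub _ (by omega), empiricalDev,
    empiricalDev, smul_eq_mul, smul_eq_mul]
  field_simp
  push_cast
  ring

theorem descendant_ratio_le (hs : 2 ≤ s) (k : ℕ) :
    (firstDescendant s k + s ^ k : ℕ) / (s : ℝ) ^ k ≤ 3 ∧
      firstDescendant s k / (s : ℝ) ^ k ≤ 2 := by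
  have hs0 : (0 : ℝ) < (s : ℝ) ^ k := by positivity
  have h : (firstDescendant s k : ℝ) ≤ 2 * (s : ℝ) ^ k := by
    exact_mod_cast (firstDescendant_lt hs k).le
  rw [div_le_iff₀ hs0, div_le_iff₀ hs0]
  push_cast
  constructor <;> linarith

theorem tendsto_firstDescendant (hs : 2 ≤ s) : Tendsto (firstDescendant s) atTop atTop :=
  tendsto_atTop_mono (pow_le_firstDescendant s) (tendsto_pow_atTop_atTop_of_one_lt hs)

theorem tendsto_firstDescendant_add (hs : 2 ≤ s) :
    Tendsto (fun k => firstDescendant s k + s ^ k) atTop atTop :=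
  tendsto_atTop_mono (fun _ => Nat.le_add_right _ _) (tendsto_firstDescendant hs)

namespace IsIIDPos

theorem identDistrib_log (hX : IsIIDPos μ X) (i : ℕ) :
    IdentDistrib (fun x => Real.log (X i x)) (fun x => Real.log (X 0 x)) μ μ :=
  ((hX.ident i).trans (hX.ident 0).symm).comp Real.measurable_log

theorem pairwise_indepFun_log (hX : IsIIDPos μ X) :
    Pairwise (Function.onFun (fun f g : Ω → ℝ => IndepFun f g μ)
      (fun i x => Real.log (X i x))) := fun _ _ hij =>
  (hX.indep.indepFun hij).comp Real.measurable_log Real.measurable_log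

theorem ae_tendsto_empiricalDev (hX : IsIIDPos μ X) (hH : ∀ i x, 1 / 2 ≤ X i x) :
    ∀ᵐ x ∂μ, Tendsto (fun n => empiricalDev μ X n x) atTop (𝓝 0) := by
  filter_upwards [strong_law_ae_real (fun i x => Real.log (X i x)) (hX.integrable_log_apply hH 0)
    hX.pairwise_indepFun_log hX.identDistrib_log] with x hx
  rw [hX.integral_log_apply 0] at hx
  have := hx.sub_const (logMean μ X)
  rw [sub_self] at this
  refine this.congr fun n => ?_
  rw [empiricalDev, smul_eq_mul, inv_mul_eq_div]

theorem tendsto_eLpNorm_empiricalDev (hX : IsIIDPos μ X) (hH : ∀ i x, 1 / 2 ≤ X i x) :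
    Tendsto (fun n => eLpNorm (empiricalDev μ X n) 1 μ) atTop (𝓝 0) := by
  have := hX.indep.isProbabilityMeasure
  have h := strong_law_Lp (μ := μ) le_rfl ENNReal.one_ne_top (fun i x => Real.log (X i x))
    (memLp_one_iff_integrable.2 (hX.integrable_log_apply hH 0))
    hX.pairwise_indepFun_log hX.identDistrib_log
  rw [hX.integral_log_apply 0] at h
  exact h

theorem measurable_empiricalDev (hX : IsIIDPos μ X) (n : ℕ) :
    Measurable (empiricalDev μ X n) := by
  unfold empiricalDev
  simp_rw [smul_eq_mul]
  exact ((Finset.measurable_fun_sum _ fun i _ => (hX.meas i).log).const_mul _).sub_const _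

theorem ae_tendsto_blockAverage (hX : IsIIDPos μ X) (hH : ∀ i x, 1 / 2 ≤ X i x) (hs : 2 ≤ s) :
    ∀ᵐ x ∂μ, Tendsto (fun k => blockAverage s X k x) atTop (𝓝 (logMean μ X)) := by
  filter_upwards [hX.ae_tendsto_empiricalDev hH] with x hx
  have h1 := (hx.comp (tendsto_firstDescendant_add hs)).abs
  have h2 := (hx.comp (tendsto_firstDescendant hs)).abs
  have h3 := (h1.const_mul 3).add (h2.const_mul 2)
  simp only [abs_zero, mul_zero, add_zero] at h3
  rw [tendsto_iff_norm_sub_tendsto_zero]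
  refine squeeze_zero (fun k => norm_nonneg _) (fun k => ?_) h3
  obtain ⟨hr1, hr2⟩ := descendant_ratio_le hs k
  rw [Real.norm_eq_abs, blockAverage_sub_logMean (μ := μ) hs]
  refine (abs_sub _ _).trans ?_
  have e1 : (0 : ℝ) ≤ (firstDescendant s k + s ^ k : ℕ) / (s : ℝ) ^ k := by positivity
  have e2 : (0 : ℝ) ≤ firstDescendant s k / (s : ℝ) ^ k := by positivity
  rw [abs_mul, abs_mul, abs_of_nonneg e1, abs_of_nonneg e2]
  exact add_le_add (mul_le_mul_of_nonneg_right hr1 (abs_nonneg _))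
    (mul_le_mul_of_nonneg_right hr2 (abs_nonneg _))

theorem tendsto_eLpNorm_blockAverage (hX : IsIIDPos μ X) (hH : ∀ i x, 1 / 2 ≤ X i x)
    (hs : 2 ≤ s) :
    Tendsto (fun k => eLpNorm (fun x => blockAverage s X k x - logMean μ X) 1 μ) atTop (𝓝 0) := by
  have h := hX.tendsto_eLpNorm_empiricalDev hH
  have h1 := ENNReal.Tendsto.const_mul (a := 3) (h.comp (tendsto_firstDescendant_add hs))
    (Or.inr (by norm_num))
  have h2 := ENNReal.Tendsto.const_mul (a := 2) (h.comp (tendsto_firstDescendant hs))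
    (Or.inr (by norm_num))
  have h3 := h1.add h2
  simp only [mul_zero, add_zero] at h3
  refine tendsto_of_tendsto_of_tendsto_of_le_of_le tendsto_const_nhds h3 (fun k => bot_le)
    fun k => ?_
  obtain ⟨hr1, hr2⟩ := descendant_ratio_le hs k
  have he : (fun x => blockAverage s X k x - logMean μ X)
      = ((firstDescendant s k + s ^ k : ℕ) / (s : ℝ) ^ k)
          • empiricalDev μ X (firstDescendant s k + s ^ k)
        - (firstDescendant s k / (s : ℝ) ^ k) • empiricalDev μ X (firstDescendant s k) := by
    funext x
    exact blockAverage_sub_logMean hs k x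
  show eLpNorm (fun x => blockAverage s X k x - logMean μ X) 1 μ ≤ _
  rw [he]
  refine (eLpNorm_sub_le ((hX.measurable_empiricalDev _).const_smul _).aestronglyMeasurable
    ((hX.measurable_empiricalDev _).const_smul _).aestronglyMeasurable le_rfl).trans ?_
  rw [eLpNorm_const_smul, eLpNorm_const_smul]
  have e1 : ‖((firstDescendant s k + s ^ k : ℕ) / (s : ℝ) ^ k)‖ₑ ≤ 3 := by
    rw [Real.enorm_eq_ofReal (by positivity), ← ENNReal.ofReal_ofNat 3]
    exact ENNReal.ofReal_le_ofReal hr1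
  have e2 : ‖(firstDescendant s k / (s : ℝ) ^ k)‖ₑ ≤ 2 := by
    rw [Real.enorm_eq_ofReal (by positivity), ← ENNReal.ofReal_ofNat 2]
    exact ENNReal.ofReal_le_ofReal hr2
  exact add_le_add (mul_le_mul_left e1 _) (mul_le_mul_left e2 _)

theorem abs_logMean_step_sub_le (hX : IsIIDPos μ X) (hH : ∀ i x, 1 / 2 ≤ X i x) (hs : 2 ≤ s) :
    |logMean μ (HierarchicalPinning.step s X) - s * logMean μ X| ≤ s := by
  have := hX.indep.isProbabilityMeasure
  have i1 := (hX.step hs).integrable_log (half_le_step hs hX.pos)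
  have i2 := hX.integrable_log_childProd (s := s) hH
  rw [← hX.integral_log_childProd hH, logMean, ← integral_sub i1 i2]
  have h := norm_integral_le_of_norm_le_const (μ := μ) (C := (s : ℝ))
    (f := fun x => Real.log (HierarchicalPinning.step s X 1 x) - Real.log (childProd s X x))
    (ae_of_all _ fun x => by
      rw [log_childProd hX.pos]
      exact abs_log_step_sub_le hs hH 1 x)
  simpa using h

/-- The normalized mean logarithms converge, with an explicit rate. -/
theorem exists_limit_logMean (hX : IsIIDPos μ X) (hH : ∀ i x, 1 / 2 ≤ X i x) (hs : 2 ≤ s) :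
    ∃ f : ℝ, ∀ n : ℕ,
      |logMean μ ((HierarchicalPinning.step s)^[n] X) / (s : ℝ) ^ n - f| ≤ 2 * (1 / (s : ℝ)) ^ n := by
  have hs2 : (2 : ℝ) ≤ s := by exact_mod_cast hs
  have hs0 : (0 : ℝ) < s := by linarith
  have hr : 1 / (s : ℝ) ≤ 1 / 2 := one_div_le_one_div_of_le two_pos hs2
  have hr1 : 1 / (s : ℝ) < 1 := by linarith
  have hd : ∀ n, dist (logMean μ ((HierarchicalPinning.step s)^[n] X) / (s : ℝ) ^ n)
      (logMean μ ((HierarchicalPinning.step s)^[n + 1] X) / (s : ℝ) ^ (n + 1))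
      ≤ 1 * (1 / (s : ℝ)) ^ n := by
    intro n
    have h := (hX.iterate_step hs n).abs_logMean_step_sub_le (half_le_iterate_step hs hH n) hs
    rw [Function.iterate_succ_apply', dist_comm, Real.dist_eq, one_mul, one_div_pow]
    have he : logMean μ (HierarchicalPinning.step s ((HierarchicalPinning.step s)^[n] X))
          / (s : ℝ) ^ (n + 1) - logMean μ ((HierarchicalPinning.step s)^[n] X) / (s : ℝ) ^ n
        = (logMean μ (HierarchicalPinning.step s ((HierarchicalPinning.step s)^[n] X))
          - s * logMean μ ((HierarchicalPinning.step s)^[n] X)) / (s : ℝ) ^ (n + 1) := by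
      rw [pow_succ]; field_simp
    rw [he, abs_div, abs_of_pos (show (0 : ℝ) < (s : ℝ) ^ (n + 1) by positivity)]
    calc _ ≤ (s : ℝ) / (s : ℝ) ^ (n + 1) := by gcongr
      _ = _ := by rw [pow_succ]; field_simp
  obtain ⟨f, hf⟩ := cauchySeq_tendsto_of_complete (cauchySeq_of_le_geometric _ _ hr1 hd)
  refine ⟨f, fun n => ?_⟩
  have h := dist_le_of_le_geometric_of_tendsto _ _ hr1 hd hf n
  rw [Real.dist_eq] at h
  refine h.trans ?_
  -- The geometric tail contributes `1 / (1 - 1 / s) ≤ 2`.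
  rw [div_le_iff₀ (by linarith), one_mul]
  nlinarith [pow_pos (show 0 < 1 / (s : ℝ) by positivity) n]

/-- Separates the fluctuation at a fixed generation `n`, which vanishes as `k → ∞`, from an error
uniform in `k` and in the sample point, which vanishes as `n → ∞`. -/
theorem abs_log_iterate_sub_limit_le (hs : 2 ≤ s) (hH : ∀ i x, 1 / 2 ≤ X i x) {f : ℝ} {n : ℕ}
    (hf : |logMean μ ((HierarchicalPinning.step s)^[n] X) / (s : ℝ) ^ n - f|
      ≤ 2 * (1 / (s : ℝ)) ^ n) (k : ℕ) (x : Ω) :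
    |Real.log ((HierarchicalPinning.step s)^[k + n] X 1 x) / (s : ℝ) ^ (k + n) - f|
      ≤ |blockAverage s ((HierarchicalPinning.step s)^[n] X) k x
          - logMean μ ((HierarchicalPinning.step s)^[n] X)| + (s + 2) * (1 / (s : ℝ)) ^ n := by
  have hs1 : (1 : ℝ) ≤ s := by exact_mod_cast (by omega : 1 ≤ s)
  have hs0 : (0 : ℝ) < s := by linarith
  rw [Function.iterate_add_apply]
  set Y := (HierarchicalPinning.step s)^[n] X with hY
  have h1 := abs_log_iterate_step_sub_le hs (half_le_iterate_step hs hH n) x k 1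
  rw [← hY] at h1
  set A := (childSum s)^[k] (fun j => Real.log (Y j x)) 1 with hA
  have hk : (0 : ℝ) < (s : ℝ) ^ k := by positivity
  have hn : (0 : ℝ) < (s : ℝ) ^ n := by positivity
  have e1 : Real.log ((HierarchicalPinning.step s)^[k] Y 1 x) / (s : ℝ) ^ (k + n) - f
      = (Real.log ((HierarchicalPinning.step s)^[k] Y 1 x) - A) / (s : ℝ) ^ (k + n)
        + (blockAverage s Y k x - logMean μ Y) / (s : ℝ) ^ n
        + (logMean μ Y / (s : ℝ) ^ n - f) := by
    rw [blockAverage, ← hA, pow_add]; field_simp; ring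
  rw [e1]
  refine (abs_add_three _ _ _).trans ?_
  have h2 : |(Real.log ((HierarchicalPinning.step s)^[k] Y 1 x) - A) / (s : ℝ) ^ (k + n)|
      ≤ s * (1 / (s : ℝ)) ^ n := by
    rw [abs_div, abs_of_pos (show (0 : ℝ) < (s : ℝ) ^ (k + n) by positivity),
      div_le_iff₀ (by positivity)]
    refine h1.trans ?_
    rw [one_div_pow, pow_add]
    field_simp
    linarith
  have h3 : |(blockAverage s Y k x - logMean μ Y) / (s : ℝ) ^ n|
      ≤ |blockAverage s Y k x - logMean μ Y| := by
    rw [abs_div, abs_of_pos hn]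
    exact div_le_self (abs_nonneg _) (one_le_pow₀ hs1)
  linarith

/-- The normalized logarithms converge almost surely and in `L¹` to a constant. -/
theorem exists_limit_log (hX : IsIIDPos μ X) (hH : ∀ i x, 1 / 2 ≤ X i x) (hs : 2 ≤ s) :
    ∃ f : ℝ,
      (∀ᵐ x ∂μ, Tendsto (fun N => Real.log ((HierarchicalPinning.step s)^[N] X 1 x) / (s : ℝ) ^ N)
        atTop (𝓝 f)) ∧
      Tendsto (fun N => eLpNorm (fun x =>
        Real.log ((HierarchicalPinning.step s)^[N] X 1 x) / (s : ℝ) ^ N - f) 1 μ) atTop (𝓝 0) ∧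
      ∀ n : ℕ, |logMean μ ((HierarchicalPinning.step s)^[n] X) / (s : ℝ) ^ n - f|
        ≤ 2 * (1 / (s : ℝ)) ^ n := by
  have := hX.indep.isProbabilityMeasure
  have hs2 : (2 : ℝ) ≤ s := by exact_mod_cast hs
  have hs0 : (0 : ℝ) < s := by linarith
  obtain ⟨f, hf⟩ := hX.exists_limit_logMean hH hs
  have hzero : Tendsto (fun n : ℕ => ((s : ℝ) + 2) * (1 / (s : ℝ)) ^ n) atTop (𝓝 0) := by
    have h := (tendsto_pow_atTop_nhds_zero_of_lt_one (r := 1 / (s : ℝ)) (by positivity)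
      ((div_lt_one hs0).2 (by linarith))).const_mul ((s : ℝ) + 2)
    rwa [mul_zero] at h
  refine ⟨f, ?_, ?_, hf⟩
  · have hall : ∀ᵐ x ∂μ, ∀ n, Tendsto
        (fun k => blockAverage s ((HierarchicalPinning.step s)^[n] X) k x) atTop
        (𝓝 (logMean μ ((HierarchicalPinning.step s)^[n] X))) :=
      ae_all_iff.2 fun n =>
        (hX.iterate_step hs n).ae_tendsto_blockAverage (half_le_iterate_step hs hH n) hs
    filter_upwards [hall] with x hx
    rw [Metric.tendsto_atTop']
    intro ε hε
    obtain ⟨n, hn⟩ := (hzero.eventually_lt_const (half_pos hε)).exists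
    obtain ⟨K, hK⟩ := Metric.tendsto_atTop'.1 (hx n) (ε / 2) (half_pos hε)
    refine ⟨K + n, fun N hN => ?_⟩
    obtain ⟨k, rfl⟩ : ∃ k, N = k + n := ⟨N - n, by omega⟩
    have h1 := abs_log_iterate_sub_limit_le hs hH (hf n) k x
    have h2 := hK k (by omega)
    rw [Real.dist_eq] at h2 ⊢
    linarith
  · rw [ENNReal.tendsto_nhds_zero]
    intro ε hε
    have hzero' := ENNReal.tendsto_ofReal hzero
    rw [ENNReal.ofReal_zero] at hzero'
    have hε2 : 0 < ε / 2 := ENNReal.half_pos hε.ne'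
    obtain ⟨n, hn⟩ := (hzero'.eventually_lt_const hε2).exists
    have hY := hX.iterate_step hs n
    have hev := (hY.tendsto_eLpNorm_blockAverage (half_le_iterate_step hs hH n)
      hs).eventually_lt_const hε2
    obtain ⟨K, hK⟩ := eventually_atTop.1 hev
    refine eventually_atTop.2 ⟨K + n, fun N hN => ?_⟩
    obtain ⟨k, rfl⟩ : ∃ k, N = k + n := ⟨N - n, by omega⟩
    have hmeasB : Measurable (fun x => blockAverage s ((HierarchicalPinning.step s)^[n] X) k x
        - logMean μ ((HierarchicalPinning.step s)^[n] X)) := by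
      simp_rw [blockAverage, iterate_childSum]
      exact ((Finset.measurable_fun_sum _ fun i _ => (hY.meas i).log).div_const _).sub_const _
    calc _ ≤ eLpNorm (fun x => |blockAverage s ((HierarchicalPinning.step s)^[n] X) k x
          - logMean μ ((HierarchicalPinning.step s)^[n] X)|
          + ((s : ℝ) + 2) * (1 / (s : ℝ)) ^ n) 1 μ :=
          eLpNorm_mono_real fun x => abs_log_iterate_sub_limit_le hs hH (hf n) k x
      _ ≤ eLpNorm (fun x => |blockAverage s ((HierarchicalPinning.step s)^[n] X) k x
          - logMean μ ((HierarchicalPinning.step s)^[n] X)|) 1 μ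
          + eLpNorm (fun _ : Ω => ((s : ℝ) + 2) * (1 / (s : ℝ)) ^ n) 1 μ :=
          eLpNorm_add_le hmeasB.abs.aestronglyMeasurable
            aestronglyMeasurable_const le_rfl
      _ ≤ ε / 2 + ε / 2 := by
          refine add_le_add ?_ ?_
          · have h1 := (hK k (by omega)).le
            have e := eLpNorm_norm (μ := μ) (p := 1)
              fun x => blockAverage s ((HierarchicalPinning.step s)^[n] X) k x
                - logMean μ ((HierarchicalPinning.step s)^[n] X)
            simp only [Real.norm_eq_abs] at e
            rw [e]
            exact h1
          · rw [eLpNorm_const _ one_ne_zero (IsProbabilityMeasure.ne_zero μ)]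
            simp only [measure_univ, ENNReal.one_rpow, mul_one]
            rw [Real.enorm_eq_ofReal (by positivity)]
            exact hn.le
      _ = ε := ENNReal.add_halves ε

end IsIIDPos

end HierarchicalPinning

/-! ### Sign of the free energy and the critical point. -/

namespace HierarchicalPinning

theorem step_lt_step {Ω : Type*} {s : ℕ} {X X' : ℕ → Ω → ℝ} (hs : 2 ≤ s)
    (hpos : ∀ i x, 0 < X i x) (hlt : ∀ i x, X i x < X' i x) (i : ℕ) (x : Ω) :
    step s X i x < step s X' i x := by
  have hs0 : (0 : ℝ) < s := by positivity
  have h := Finset.prod_lt_prod_of_nonempty (s := Finset.Icc 1 s)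
    (fun j _ => hpos (s * i + j) x) (fun j _ => hlt (s * i + j) x)
    (Finset.nonempty_Icc.2 (by omega))
  unfold step
  gcongr

variable {Ω : Type*} [MeasurableSpace Ω] {μ : Measure Ω} {s : ℕ} {X X' : ℕ → Ω → ℝ}

theorem IsIIDPos.logMean_lt (hX : IsIIDPos μ X) (hX' : IsIIDPos μ X')
    (hH : ∀ i x, 1 / 2 ≤ X i x) (hlt : ∀ i x, X i x < X' i x) :
    logMean μ X < logMean μ X' := by
  have := hX.indep.isProbabilityMeasure
  have hH' : ∀ i x, 1 / 2 ≤ X' i x := fun i x => (hH i x).trans (hlt i x).le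
  have i1 := hX.integrable_log hH
  have i2 := hX'.integrable_log hH'
  have hpos : ∀ x, 0 < Real.log (X' 1 x) - Real.log (X 1 x) := fun x =>
    sub_pos.2 (Real.log_lt_log (hX.pos 1 x) (hlt 1 x))
  have h := (integral_pos_iff_support_of_nonneg (fun x => (hpos x).le) (i2.sub' i1)).2 (by
    rw [Function.support_eq_univ fun x => (hpos x).ne', measure_univ]
    exact one_pos)
  rw [integral_sub i2 i1] at h
  exact sub_pos.1 h

theorem IsFreeEnergy.unique [IsProbabilityMeasure μ] {ω : ℕ → Ω → ℝ} {b : ℕ} {β h f f' : ℝ}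
    (hf : IsFreeEnergy μ ω b s β h f) (hf' : IsFreeEnergy μ ω b s β h f') : f = f' := by
  obtain ⟨x, hx, hx'⟩ := (hf.1.and hf'.1).exists
  exact tendsto_nhds_unique hx hx'

theorem IsFreeEnergy.freeEnergy_eq [IsProbabilityMeasure μ] {ω : ℕ → Ω → ℝ} {b : ℕ} {β h f : ℝ}
    (hf : IsFreeEnergy μ ω b s β h f) : freeEnergy μ ω b s β h = f :=
  (Classical.epsilon_spec ⟨f, hf⟩ : IsFreeEnergy μ ω b s β h (freeEnergy μ ω b s β h)).unique hf

/-- The initial weights need not be bounded below, but after one step all variables are at least `1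
/ 2`. Starting there shifts the generation by one, hence the division by `s`. -/
theorem isFreeEnergy_of_tendsto {ω : ℕ → Ω → ℝ} {β h f : ℝ}
    (hae : ∀ᵐ x ∂μ, Tendsto (fun N => Real.log ((step s)^[N]
      (step s (partitionFn μ ω s s β h 0)) 1 x) / (s : ℝ) ^ N) atTop (𝓝 f))
    (hL1 : Tendsto (fun N => eLpNorm (fun x => Real.log ((step s)^[N]
      (step s (partitionFn μ ω s s β h 0)) 1 x) / (s : ℝ) ^ N - f) 1 μ) atTop (𝓝 0)) :
    IsFreeEnergy μ ω s s β h (f / s) := by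
  have he : ∀ N x, finiteFreeEnergy μ ω s s β h (N + 1) x = Real.log ((step s)^[N]
      (step s (partitionFn μ ω s s β h 0)) 1 x) / (s : ℝ) ^ N / s := by
    intro N x
    rw [finiteFreeEnergy, partitionFn_eq_iterate_step, Function.iterate_succ_apply, pow_succ,
      one_div_mul_eq_div, div_div]
  constructor
  · filter_upwards [hae] with x hx
    rw [← tendsto_add_atTop_iff_nat 1]
    simp_rw [he]
    exact hx.div_const _
  · rw [← tendsto_add_atTop_iff_nat 1]
    simp_rw [he]
    have h1 := ENNReal.Tendsto.const_mul (a := ‖(s : ℝ)⁻¹‖ₑ) hL1 (Or.inr enorm_ne_top)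
    rw [mul_zero] at h1
    refine h1.congr fun N => ?_
    rw [← eLpNorm_const_smul]
    congr 1
    funext x
    simp only [Pi.smul_apply, smul_eq_mul]
    ring

section Disorder

variable [IsProbabilityMeasure μ] {ω : ℕ → Ω → ℝ}

theorem integrable_exp_disorder (hM : ∀ β : ℝ, 0 < β → Integrable (fun x => Real.exp (β * ω 1 x)) μ)
    {β : ℝ} (hβ : 0 ≤ β) : Integrable (fun x => Real.exp (β * ω 1 x)) μ := by
  rcases hβ.eq_or_lt with rfl | hβ
  · simp
  · exact hM β hβ

theorem isIIDPos_partitionFn_zero (hmeas : ∀ n, Measurable (ω n)) (hindep : iIndepFun ω μ)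
    (hident : ∀ n, IdentDistrib (ω n) (ω 1) μ μ)
    (hM : ∀ β : ℝ, 0 < β → Integrable (fun x => Real.exp (β * ω 1 x)) μ) (b : ℕ)
    {β : ℝ} (hβ : 0 ≤ β) (h : ℝ) : IsIIDPos μ (partitionFn μ ω b s β h 0) := by
  have hg : Measurable fun y : ℝ => Real.exp (β * y + h - Real.log (mgf (ω 1) μ β)) := by fun_prop
  refine ⟨fun i => hg.comp (hmeas i), hindep.comp (fun _ => _) fun _ => hg,
    fun i => (hident i).comp hg, fun i x => Real.exp_pos _, fun p => ?_⟩
  have h1 := (integrable_exp_disorder hM (show 0 ≤ p * β by positivity)).mul_const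
    (Real.exp (p * (h - Real.log (mgf (ω 1) μ β))))
  refine h1.congr (ae_of_all _ fun x => ?_)
  show Real.exp (p * β * ω 1 x) * Real.exp (p * (h - Real.log (mgf (ω 1) μ β)))
    = Real.exp (β * ω 1 x + h - Real.log (mgf (ω 1) μ β)) ^ p
  rw [← Real.exp_nat_mul, ← Real.exp_add]
  congr 1; ring

theorem mean_partitionFn_zero
    (hM : ∀ β : ℝ, 0 < β → Integrable (fun x => Real.exp (β * ω 1 x)) μ) (b : ℕ)
    {β : ℝ} (hβ : 0 ≤ β) (h : ℝ) : mean μ (partitionFn μ ω b s β h 0) = Real.exp h := by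
  have hpos := mgf_pos (integrable_exp_disorder hM hβ)
  have he : ∀ x, partitionFn μ ω b s β h 0 1 x
      = Real.exp (β * ω 1 x) * (Real.exp h / mgf (ω 1) μ β) := fun x => by
    rw [partitionFn, Real.exp_sub, Real.exp_add, Real.exp_log hpos, mul_div_assoc]
  unfold mean
  simp_rw [he]
  rw [integral_mul_const]
  show mgf (ω 1) μ β * _ = _
  field_simp

/-- The free energy exists, and it is positive exactly for positive pinning parameter. -/
theorem exists_isFreeEnergy (hmeas : ∀ n, Measurable (ω n)) (hindep : iIndepFun ω μ)
    (hident : ∀ n, IdentDistrib (ω n) (ω 1) μ μ)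
    (hM : ∀ β : ℝ, 0 < β → Integrable (fun x => Real.exp (β * ω 1 x)) μ) (hs : 2 ≤ s)
    {β : ℝ} (hβ : 0 ≤ β) (h : ℝ) :
    ∃ f, IsFreeEnergy μ ω s s β h f ∧ (0 < f ↔ 0 < h) := by
  have hs2 : (2 : ℝ) ≤ s := by exact_mod_cast hs
  have hs0 : (0 : ℝ) < s := by linarith
  have hX0 : ∀ h, IsIIDPos μ (partitionFn μ ω s s β h 0) := fun h =>
    isIIDPos_partitionFn_zero hmeas hindep hident hM s hβ h
  have hX := fun h => (hX0 h).step hs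
  have hH : ∀ h i x, 1 / 2 ≤ step s (partitionFn μ ω s s β h 0) i x := fun h =>
    half_le_step hs (hX0 h).pos
  obtain ⟨f, hae, hL1, hf⟩ := (hX h).exists_limit_log (hH h) hs
  refine ⟨f / s, isFreeEnergy_of_tendsto hae hL1, ?_⟩
  rw [div_pos_iff_of_pos_right hs0]
  constructor
  · contrapose!
    intro hh
    have hzero : Tendsto (fun n : ℕ => 2 * (1 / (s : ℝ)) ^ n) atTop (𝓝 0) := by
      have h := (tendsto_pow_atTop_nhds_zero_of_lt_one (r := 1 / (s : ℝ)) (by positivity)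
        ((div_lt_one hs0).2 (by linarith))).const_mul 2
      rwa [mul_zero] at h
    have hmean : mean μ (step s (partitionFn μ ω s s β h 0)) ≤ 1 :=
      (hX0 h).mean_iterate_step_le_one hs
        ((mean_partitionFn_zero hM s hβ h).trans_le (Real.exp_le_one_iff.2 hh)) 1
    refine ge_of_tendsto' hzero fun n => ?_
    have h1 := ((hX h).iterate_step hs n).logMean_le_mean_sub_one
      (half_le_iterate_step hs (hH h) n)
    have h2 := (hX h).mean_iterate_step_le_one hs hmean n
    have h3 : logMean μ ((step s)^[n] (step s (partitionFn μ ω s s β h 0))) / (s : ℝ) ^ n ≤ 0 :=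
      div_nonpos_of_nonpos_of_nonneg (by linarith) (by positivity)
    have h4 := (abs_le.1 (hf n)).1
    linarith
  · intro hh
    have hm : mean μ (step s (partitionFn μ ω s s β 0 0)) = 1 :=
      (hX0 0).mean_iterate_step_eq_one hs
        ((mean_partitionFn_zero hM s hβ 0).trans Real.exp_zero) 1
    have hlt : ∀ i x, step s (partitionFn μ ω s s β 0 0) i x
        < step s (partitionFn μ ω s s β h 0) i x :=
      step_lt_step hs (hX0 0).pos fun i x => by
        rw [partitionFn, partitionFn]
        exact Real.exp_lt_exp.2 (by linarith)
    obtain ⟨n, hn⟩ := exists_logMean_pos (hX 0) (hX h) (hH 0) (fun i x => (hlt i x).le) hs hm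
      ((hX 0).logMean_lt (hX h) (hH 0) hlt)
    obtain ⟨η, hη, hgrow⟩ := ((hX h).iterate_step hs n).exists_linear_growth
      (half_le_iterate_step hs (hH h) n) hs hn
    -- The threshold `2` is the constant in the convergence rate `2 * (1 / s) ^ n`: a mean logarithm
    -- above it forces `f > 0`.
    obtain ⟨k, hk⟩ := exists_nat_gt (2 / η)
    rw [div_lt_iff₀ hη] at hk
    have h1 := hgrow k
    rw [← Function.iterate_add_apply] at h1
    have h2 := (abs_le.1 (hf (k + n))).2
    have hp : (0 : ℝ) < (s : ℝ) ^ (k + n) := by positivity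
    have h3 : 2 * (1 / (s : ℝ)) ^ (k + n)
        < logMean μ ((step s)^[k + n] (step s (partitionFn μ ω s s β h 0))) / (s : ℝ) ^ (k + n) := by
      rw [one_div_pow, mul_one_div]
      exact div_lt_div_of_pos_right (hk.trans_le h1) hp
    linarith

theorem criticalPoint_eq_zero (hmeas : ∀ n, Measurable (ω n)) (hindep : iIndepFun ω μ)
    (hident : ∀ n, IdentDistrib (ω n) (ω 1) μ μ)
    (hM : ∀ β : ℝ, 0 < β → Integrable (fun x => Real.exp (β * ω 1 x)) μ) (hs : 2 ≤ s)
    {β : ℝ} (hβ : 0 ≤ β) : criticalPoint μ ω s s β = 0 := by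
  have hset : {h : ℝ | 0 < freeEnergy μ ω s s β h} = Set.Ioi 0 := by
    ext h
    obtain ⟨f, hf, hpos⟩ := exists_isFreeEnergy hmeas hindep hident hM hs hβ h
    rw [Set.mem_ofPred_eq, hf.freeEnergy_eq, hpos, Set.mem_Ioi]
  rw [criticalPoint, hset]
  refine le_antisymm (le_of_forall_gt fun c hc => ?_) (le_sInf ?_)
  · obtain ⟨r, hr0, hrc⟩ := EReal.lt_iff_exists_real_btwn.1 hc
    have hmem : (r : EReal) ∈ (fun h : ℝ => (h : EReal)) '' Set.Ioi 0 :=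
      ⟨r, EReal.coe_pos.1 hr0, rfl⟩
    exact (sInf_le hmem).trans_lt hrc
  · rintro _ ⟨h, hh, rfl⟩
    exact EReal.coe_nonneg.2 (le_of_lt hh)

end Disorder

end HierarchicalPinning

theorem theorem3 {Ω : Type*} [MeasurableSpace Ω] (μ : Measure Ω) [IsProbabilityMeasure μ]
    (ω : ℕ → Ω → ℝ) (hmeas : ∀ n, Measurable (ω n)) (hindep : iIndepFun ω μ)
    (hident : ∀ n, IdentDistrib (ω n) (ω 1) μ μ)
    (hM : ∀ β : ℝ, 0 < β → Integrable (fun x => Real.exp (β * ω 1 x)) μ)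
    (s : ℕ) (hs : 2 ≤ s) :
    (∀ β h : ℝ, 0 ≤ β →
      HierarchicalPinning.IsFreeEnergy μ ω s s β h
        (HierarchicalPinning.freeEnergy μ ω s s β h)) ∧
    ∀ β : ℝ, 0 < β →
      HierarchicalPinning.criticalPoint μ ω s s β = HierarchicalPinning.criticalPoint μ ω s s 0 ∧
      HierarchicalPinning.criticalPoint μ ω s s 0 = 0 := by
  refine ⟨fun β h hβ => ?_, fun β hβ => ?_⟩
  · obtain ⟨f, hf, -⟩ :=
      HierarchicalPinning.exists_isFreeEnergy hmeas hindep hident hM hs hβ h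
    rw [hf.freeEnergy_eq]
    exact hf
  · rw [HierarchicalPinning.criticalPoint_eq_zero hmeas hindep hident hM hs hβ.le,
      HierarchicalPinning.criticalPoint_eq_zero hmeas hindep hident hM hs le_rfl]
    exact ⟨rfl, rfl⟩
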